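/- Let $k$ be a field and let $F$ be a sheaf of $k$-vector spaces on $\mathbb{R}$ with compact support. Assume that $F$ is constructible: there is a real analytic stratification of $\mathbb{R}$ (a locally finite partition of $\mathbb{R}$ into connected real analytic submanifolds such that a stratum meeting the closure of another one is contained in it) such that the restriction of $F$ to each stratum is a constant sheaf of finite rank. For a nonempty interval $I \subseteq \mathbb{R}$ (open, closed or half-closed) let $k_I$ denote the sheaf on $\mathbb{R}$ that is constant with stalk $k$ on $I$ and extended by zero outside $I$. Then there exist a finite set $A$, pairwise distinct nonempty intervals $I_a \subseteq \mathbb{R}$ and integers $n_a \geq 1$, $a \in A$, such that $$F \simeq \bigoplus_{a\in A} k_{I_a}^{n_a}.$$ Moreover this decomposition is unique: if $F \simeq \bigoplus_{a\in A} k_{I_a}^{n_a}$ and $F \simeq \bigoplus_{b\in B} k_{J_b}^{m_b}$ with $A$, $B$ finite, the $I_a$ pairwise distinct nonempty intervals, the $J_b$ pairwise distinct nonempty intervals, and all $n_a, m_b \geq 1$, then there is a bijection $\sigma \colon A \to B$ such that $J_{\sigma(a)} = I_a$ and $m_{\sigma(a)} = n_a$ for all $a \in A$. -/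

import Mathlib

open CategoryTheory CategoryTheory.Limits TopologicalSpace Opposite Topology

universe u v w

noncomputable section

namespace SheavesOnR

/-! ### Sheaves of vector spaces

The coefficient field may live in any universe while the spaces are in `Type`; the instances below
only say that Mathlib's limits, colimits and sheafification are available in that situation. -/

instance (k : Type u) [Field k] : HasColimitsOfSize.{0, 0} (ModuleCat.{u} k) :=
  hasColimitsOfSizeShrink.{0, 0, u, u} _

instance (k : Type u) [Field k] : HasLimitsOfSize.{0, 0} (ModuleCat.{u} k) :=
  hasLimitsOfSizeShrink.{0, 0, u, u} _

instance (k : Type u) [Field k] : PreservesLimitsOfSize.{0, 0} (forget (ModuleCat.{u} k)) :=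
  preservesLimitsOfSize_shrink.{0, u, 0, u} _

instance (k : Type u) [Field k] :
    PreservesFilteredColimitsOfSize.{0, 0} (forget (ModuleCat.{u} k)) :=
  preservesFilteredColimitsOfSize_shrink.{0, u, 0, u} _

instance (k : Type u) [Field k] (X : TopCat.{0}) :
    HasSheafify (Opens.grothendieckTopology X) (ModuleCat.{u} k) :=
  inferInstance

/-- The category of sheaves of `k`-vector spaces on `X`. -/
abbrev Sh (k : Type u) [Field k] (X : Type) [TopologicalSpace X] :=
  TopCat.Sheaf (ModuleCat.{u} k) (TopCat.of X)

instance (k : Type u) [Field k] (X : Type) [TopologicalSpace X] : HasFiniteBiproducts (Sh k X) :=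
  Abelian.hasFiniteBiproducts

/-! ### The sheaf `k_I` -/

/-- The condition for `f : U → k` to be a section over `U` of `k_Z = i_! k`, where `i` is the
inclusion of a locally closed subset `Z` of `ℝ`: `f` restricts to a locally constant function on
`Z ∩ U`, vanishes outside `Z`, and its support `{f ≠ 0}` is closed in `U`. -/
def IsExtSection {k : Type u} [Field k] (Z : Set ℝ) {U : Opens (TopCat.of ℝ)} (f : U → k) : Prop :=
  (∀ x : U, x.1 ∉ Z → f x = 0) ∧
    IsLocallyConstant (fun x : {x : U // x.1 ∈ Z} => f x.1) ∧
    IsClosed {x : U | f x ≠ 0}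

theorem isExtSection_iff {k : Type u} [Field k] (Z : Set ℝ) {U : Opens (TopCat.of ℝ)} (f : U → k) :
    IsExtSection Z f ↔ (∀ x : U, x.1 ∉ Z → f x = 0) ∧
      (∀ x : U, x.1 ∈ Z → ∀ᶠ y in 𝓝 x, y.1 ∈ Z → f y = f x) ∧
      (∀ x : U, f x = 0 → ∀ᶠ y in 𝓝 x, f y = 0) := by
  unfold IsExtSection
  refine and_congr Iff.rfl (and_congr ?_ ?_)
  · rw [IsLocallyConstant.iff_eventually_eq]
    constructor
    · intro h x hx
      have := h ⟨x, hx⟩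
      rw [nhds_subtype_eq_comap, Filter.eventually_comap] at this
      filter_upwards [this] with y hy hyZ using hy ⟨y, hyZ⟩ rfl
    · intro h x
      rw [nhds_subtype_eq_comap, Filter.eventually_comap]
      filter_upwards [h x.1 x.2] with y hy a ha
      subst ha
      exact hy a.2
  · rw [← isOpen_compl_iff, isOpen_iff_eventually]
    simp

/-- The space of sections of `k_Z` over `U`. -/
def extSections (k : Type u) [Field k] (Z : Set ℝ) (U : Opens (TopCat.of ℝ)) :
    Submodule k (U → k) where
  carrier := {f | IsExtSection Z f}
  zero_mem' := ⟨fun _ _ => rfl, IsLocallyConstant.const 0, by simp⟩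
  add_mem' := by
    intro f g hf hg
    simp only [Set.mem_ofPred_eq, isExtSection_iff] at hf hg ⊢
    have h0 : ∀ x : U, x.1 ∉ Z → (f + g) x = 0 := fun x hx => by simp [hf.1 x hx, hg.1 x hx]
    have h1 : ∀ x : U, x.1 ∈ Z → ∀ᶠ y in 𝓝 x, y.1 ∈ Z → (f + g) y = (f + g) x := by
      intro x hx
      filter_upwards [hf.2.1 x hx, hg.2.1 x hx] with y h h' hy
      simp [h hy, h' hy]
    refine ⟨h0, h1, fun x hx => ?_⟩
    by_cases hxZ : x.1 ∈ Z
    · filter_upwards [h1 x hxZ] with y hy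
      by_cases hyZ : y.1 ∈ Z
      · rw [hy hyZ, hx]
      · exact h0 y hyZ
    · filter_upwards [hf.2.2 x (hf.1 x hxZ), hg.2.2 x (hg.1 x hxZ)] with y h h'
      simp [h, h']
  smul_mem' := by
    rintro c f ⟨hf0, hf, hfc⟩
    refine ⟨fun x hx => by simp [hf0 x hx], hf.comp (c • ·), ?_⟩
    by_cases hc : c = 0
    · simp [hc]
    · simpa [hc] using hfc

theorem isExtSection_res {k : Type u} [Field k] (Z : Set ℝ) {U V : Opens (TopCat.of ℝ)}
    (i : U ⟶ V) (f : V → k) (hf : IsExtSection Z f) :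
    IsExtSection Z (fun x : U => f ⟨x.1, i.le x.2⟩) := by
  have hc : Continuous (fun x : U => (⟨x.1, i.le x.2⟩ : V)) := by fun_prop
  rw [isExtSection_iff] at hf ⊢
  exact ⟨fun x hx => hf.1 _ hx, fun x hx => hc.continuousAt.eventually (hf.2.1 _ hx),
    fun x hx => hc.continuousAt.eventually (hf.2.2 _ hx)⟩

theorem isExtSection_locality {k : Type u} [Field k] (Z : Set ℝ) {U : Opens (TopCat.of ℝ)}
    (f : U → k) (hf : ∀ x : U, ∃ (V : Opens (TopCat.of ℝ)) (_ : x.1 ∈ V) (i : V ⟶ U),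
      IsExtSection Z (fun y : V => f ⟨y.1, i.le y.2⟩)) : IsExtSection Z f := by
  have key : ∀ (V : Opens (TopCat.of ℝ)) (i : V ⟶ U) (x : V) (P : U → Prop),
      (∀ᶠ y : V in 𝓝 x, P ⟨y.1, i.le y.2⟩) → ∀ᶠ y in 𝓝 (⟨x.1, i.le x.2⟩ : U), P y := by
    intro V i x P h
    have := (Opens.isOpenEmbedding_of_le i.le).map_nhds_eq x
    exact (this ▸ Filter.eventually_map.2 h :)
  rw [isExtSection_iff]
  refine ⟨fun x hx => ?_, fun x hx => ?_, fun x hx => ?_⟩ <;>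
    obtain ⟨V, hxV, i, h⟩ := hf x <;> rw [isExtSection_iff] at h
  · exact h.1 ⟨x.1, hxV⟩ hx
  · exact key V i ⟨x.1, hxV⟩ (fun y => y.1 ∈ Z → f y = f x) (h.2.1 ⟨x.1, hxV⟩ hx)
  · exact key V i ⟨x.1, hxV⟩ (fun y => f y = 0) (h.2.2 ⟨x.1, hxV⟩ hx)

/-- The property of being a section of `k_Z`, as a local predicate on functions. -/
def extPredicate (k : Type u) [Field k] (Z : Set ℝ) :
    TopCat.LocalPredicate (X := TopCat.of ℝ) (fun _ => k) where
  pred f := IsExtSection Z f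
  res i f hf := isExtSection_res Z i f hf
  locality f hf := isExtSection_locality Z f hf

/-- The presheaf of vector spaces `U ↦ extSections k Z U`, with restriction of functions. -/
def extPresheaf (k : Type u) [Field k] (Z : Set ℝ) :
    TopCat.Presheaf (ModuleCat.{u} k) (TopCat.of ℝ) where
  obj U := ModuleCat.of k (extSections k Z U.unop)
  map i := ModuleCat.ofHom
    { toFun := fun f => ⟨fun x => f.1 ⟨x.1, i.unop.le x.2⟩, isExtSection_res Z i.unop f.1 f.2⟩
      map_add' := fun _ _ => rfl
      map_smul' := fun _ _ => rfl }

theorem extPresheaf_isSheaf (k : Type u) [Field k] (Z : Set ℝ) : (extPresheaf k Z).IsSheaf :=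
  (TopCat.Presheaf.isSheaf_iff_isSheaf_comp' (forget (ModuleCat.{u} k)) (extPresheaf k Z)).2
    (TopCat.subpresheafToTypes.isSheaf (extPredicate k Z))

/-- The sheaf `k_Z` on `ℝ`, for `Z` locally closed: constant with stalk `k` on `Z` and extended by
zero outside `Z`. -/
def kSheaf (k : Type u) [Field k] (Z : Set ℝ) : Sh k ℝ :=
  ⟨extPresheaf k Z, extPresheaf_isSheaf k Z⟩

/-! ### Constructible sheaves on `ℝ` -/

/-- The inclusion of a subset of `ℝ`. -/
def incl (S : Set ℝ) : TopCat.of S ⟶ TopCat.of ℝ :=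
  TopCat.ofHom ⟨Subtype.val, continuous_subtype_val⟩

/-- The inverse image functor `f⁻¹`, left adjoint to the direct image `f_*`. -/
def inverseImage (k : Type u) [Field k] {X Y : TopCat.{0}} (f : X ⟶ Y) :
    TopCat.Sheaf (ModuleCat.{u} k) Y ⥤ TopCat.Sheaf (ModuleCat.{u} k) X :=
  (Opens.map f).sheafPullback (ModuleCat.{u} k)
    (Opens.grothendieckTopology Y) (Opens.grothendieckTopology X)

/-- The restriction `F|_S`, that is, the inverse image of `F` under the inclusion of `S`. -/
def restrict {k : Type u} [Field k] (F : Sh k ℝ) (S : Set ℝ) : Sh k S :=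
  (inverseImage k (incl S)).obj F

/-- The constant sheaf with stalk `V`. -/
def constSheaf {k : Type u} [Field k] (X : Type) [TopologicalSpace X] (V : ModuleCat.{u} k) :
    Sh k X :=
  (constantSheaf (Opens.grothendieckTopology (TopCat.of X)) (ModuleCat.{u} k)).obj V

/-- The sheaf is isomorphic to a constant sheaf with finite dimensional stalk. -/
def IsConstantOfFiniteRank {k : Type u} [Field k] {X : Type} [TopologicalSpace X] (G : Sh k X) :
    Prop :=
  ∃ V : ModuleCat.{u} k, Module.Finite k V ∧ Nonempty (G ≅ constSheaf X V)

open scoped Manifold ContDiff in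
/-- Real analytic (embedded, not necessarily closed) submanifolds of `ℝ`: near each of its points,
the set is mapped to a linear subspace by a real analytic local coordinate. -/
def IsAnalyticSubmanifold (S : Set ℝ) : Prop :=
  ∀ x ∈ S, ∃ φ ∈ contDiffGroupoid ω 𝓘(ℝ, ℝ), x ∈ φ.source ∧
    ∃ W : Submodule ℝ ℝ, S ∩ φ.source = φ.source ∩ φ ⁻¹' W

/-- Real analytic stratifications of `ℝ`: locally finite partitions into connected real analytic
submanifolds, subject to the frontier condition. -/
structure IsAnalyticStratification (𝒮 : Set (Set ℝ)) : Prop where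
  partition : Setoid.IsPartition 𝒮
  locallyFinite : LocallyFinite (fun S : 𝒮 => (S : Set ℝ))
  submanifold : ∀ S ∈ 𝒮, IsAnalyticSubmanifold S
  connected : ∀ S ∈ 𝒮, _root_.IsConnected S
  frontier : ∀ S ∈ 𝒮, ∀ T ∈ 𝒮, (S ∩ closure T).Nonempty → S ⊆ closure T

/-- Constructible sheaves on `ℝ`: for some real analytic stratification, the restriction to each
stratum is constant of finite rank. -/
def IsConstructible {k : Type u} [Field k] (F : Sh k ℝ) : Prop :=
  ∃ 𝒮 : Set (Set ℝ), IsAnalyticStratification 𝒮 ∧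
    ∀ S ∈ 𝒮, IsConstantOfFiniteRank (restrict F S)

/-- The support of `F`: the complement of the union of the open sets `U` with `F|_U = 0`, that is,
with `F(V) = 0` for all open `V ⊆ U`. -/
def supp {k : Type u} [Field k] (F : Sh k ℝ) : Set ℝ :=
  (⋃ U ∈ {U : Opens (TopCat.of ℝ) | ∀ V ≤ U, IsZero (F.presheaf.obj (op V))}, (U : Set ℝ))ᶜ

/-! ### Decompositions -/

/-- Nonempty intervals of `ℝ`, of any kind (open, closed or half-closed, bounded or not). -/
def IsInterval (I : Set ℝ) : Prop :=
  I.Nonempty ∧ I.OrdConnected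

/-- `F ≃ ⨁_a k_{I_a}^{n_a}` where the `I_a` are intervals. -/
def IsDecomposition {k : Type u} [Field k] (F : Sh k ℝ) {A : Type w} [Finite A]
    (I : A → Set ℝ) (n : A → ℕ) : Prop :=
  (∀ a, IsInterval (I a)) ∧
    Nonempty (F ≅ ⨁ fun a => ⨁ fun _ : Fin (n a) => kSheaf k (I a))

end SheavesOnR

end

/-! Existence is the classification of representations of a quiver of type A. Constructibility and
compact support leave a finite set `T` of points such that `F` is constant on each component of `ℝ \
T`. Number the strata from left to right, so that points get odd numbers and open intervals even
ones. The sections of `F` over the open star of a stratum are its stalk at any point of that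
stratum, and the star of a point contains the two neighbouring intervals. So `F` amounts to a zigzag
`V 0 ← V 1 → V 2 ← ⋯` of finite dimensional spaces.

Such a zigzag is a direct sum of bars (`exists_isBarcode`). By `exists_isBar` there are a compatible
family of vectors and a compatible family of functionals on a common bar, with pairing 1; they split
this bar off, and the total dimension drops. Back on the line, the functionals of a bar, applied to
the germs of a section of `F`, give a section of `k_I`, where `I` is the union of the strata of the
bar. Together these morphisms are bijective on stalks, hence an isomorphism (`isIso_lift_barHom`).

Uniqueness is a Krull–Schmidt argument made explicit. A morphism `k_I ⟶ k_J` is multiplication by a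
function, constant on `I` if `I = J` (`exists_coeff`), and a composite `k_I ⟶ k_J ⟶ k_I` with `I ≠
J` is zero (`homApply_comp_eq_zero`). Hence an isomorphism between two sums induces, on the summands
equal to a given `k_S`, a matrix of scalars with a left inverse, which bounds one multiplicity by
the other (`card_le_card_of_iso`). -/

noncomputable section

namespace SheavesOnR

/-! ### Sections of sheaves -/

section Sections

variable {k : Type u} [Field k] {X : TopCat.{0}}

/-- The restriction map between the spaces of sections of a sheaf. -/
def res (F : TopCat.Sheaf (ModuleCat.{u} k) X) {U V : Opens X} (h : V ≤ U) :
    F.obj.obj (op U) →ₗ[k] F.obj.obj (op V) :=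
  (F.obj.map (homOfLE h).op).hom

variable (F : TopCat.Sheaf (ModuleCat.{u} k) X)

theorem res_res {U V W : Opens X} (h : V ≤ U) (h' : W ≤ V) (s : F.obj.obj (op U)) :
    res F h' (res F h s) = res F (h'.trans h) s := by
  change (F.obj.map (homOfLE h).op ≫ F.obj.map (homOfLE h').op).hom s = _
  rw [← F.obj.map_comp]
  rfl

theorem res_self {U : Opens X} (h : U ≤ U) (s : F.obj.obj (op U)) : res F h s = s := by
  change (F.obj.map (𝟙 (op U))).hom s = s
  rw [F.obj.map_id]
  rfl

theorem hom_res {F G : TopCat.Sheaf (ModuleCat.{u} k) X} (α : F ⟶ G) {U V : Opens X} (h : V ≤ U)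
    (s : F.obj.obj (op U)) :
    (α.hom.app (op V)).hom (res F h s) = res G h ((α.hom.app (op U)).hom s) :=
  congrArg (fun f => f.hom s) (α.hom.naturality (homOfLE h).op)

theorem eq_of_locally_res_eq {U : Opens X} (s t : F.obj.obj (op U))
    (h : ∀ x ∈ U, ∃ (V : Opens X) (hV : V ≤ U), x ∈ V ∧ res F hV s = res F hV t) : s = t := by
  choose V hV hx hst using h
  refine F.eq_of_locally_eq' (fun x : U => V x.1 x.2) U (fun x => homOfLE (hV x.1 x.2)) ?_ s t
    fun x => hst x.1 x.2
  intro x hxU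
  exact Opens.mem_iSup.2 ⟨⟨x, hxU⟩, hx x hxU⟩

theorem eq_of_res_eq_of_le_sup {U A B : Opens X} (hA : A ≤ U) (hB : B ≤ U) (hU : U ≤ A ⊔ B)
    {s t : F.obj.obj (op U)} (h : res F hA s = res F hA t) (h' : res F hB s = res F hB t) :
    s = t := by
  refine eq_of_locally_res_eq F s t fun x hx => ?_
  rcases hU hx with hx | hx
  exacts [⟨A, hA, hx, h⟩, ⟨B, hB, hx, h'⟩]

theorem exists_res_eq_of_le_sup {U A B : Opens X} (hA : A ≤ U) (hB : B ≤ U) (hU : U ≤ A ⊔ B)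
    (s : F.obj.obj (op A)) (t : F.obj.obj (op B))
    (h : res F (inf_le_left : A ⊓ B ≤ A) s = res F (inf_le_right : A ⊓ B ≤ B) t) :
    ∃ r : F.obj.obj (op U), res F hA r = s ∧ res F hB r = t := by
  have := F.existsUnique_gluing' (fun b : Bool => cond b A B) U
    (fun b => homOfLE (by cases b; exacts [hB, hA])) ?_
    (fun b => by cases b; exacts [t, s]) ?_
  · obtain ⟨r, hr, -⟩ := this
    exact ⟨r, hr true, hr false⟩
  · intro x hx
    rcases hU hx with hx | hx
    exacts [Opens.mem_iSup.2 ⟨true, hx⟩, Opens.mem_iSup.2 ⟨false, hx⟩]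
  · rintro (_ | _) (_ | _)
    · rfl
    · have hi : B ⊓ A ≤ A ⊓ B := by rw [inf_comm]
      have := congrArg (res F hi) h.symm
      rwa [res_res, res_res] at this
    · exact h
    · rfl

theorem subsingleton_sections {U : Opens X} (hU : ∀ x, x ∉ U) :
    Subsingleton (F.obj.obj (op U)) :=
  ⟨fun s t => eq_of_locally_res_eq F s t fun x hx => (hU x hx).elim⟩

theorem isIso_of_locally_bijective {F G : TopCat.Sheaf (ModuleCat.{u} k) X} (α : F ⟶ G)
    (hinj : ∀ (U : Opens X) (s : F.obj.obj (op U)), (α.hom.app (op U)).hom s = 0 → s = 0)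
    (hsurj : ∀ (U : Opens X) (t : G.obj.obj (op U)), ∀ x ∈ U, ∃ (V : Opens X) (hV : V ≤ U),
      x ∈ V ∧ ∃ s : F.obj.obj (op V), (α.hom.app (op V)).hom s = res G hV t) : IsIso α := by
  refine (Sheaf.isLocallyBijective_iff_isIso (J := Opens.grothendieckTopology X) α).1 ⟨?_, ?_⟩
  · refine Presheaf.isLocallyInjective_of_injective _ α.hom fun U s t hst => ?_
    have hst' : (α.hom.app U).hom s = (α.hom.app U).hom t := hst
    have := hinj U.unop (s - t) (by
      have := map_sub (α.hom.app U).hom s t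
      rw [hst', sub_self] at this
      exact this)
    exact sub_eq_zero.1 this
  · change Presheaf.IsLocallySurjective _ α.hom
    refine ⟨fun {U} t x hx => ?_⟩
    obtain ⟨V, hV, hxV, s, hs⟩ := hsurj U t x hx
    exact ⟨V, homOfLE hV, ⟨s, hs⟩, hxV⟩

end Sections

/-! ### Constant sheaves -/

section Constant

variable (k : Type u) [Field k] (X : TopCat.{0})

/-- This is what makes sheafification computable: the unit is locally injective and locally
surjective. The open sets form a category in universe 0 while the modules live in universe `u`,
hence the passage to an equivalent small site. -/
theorem wEqualsLocallyBijective :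
    (Opens.grothendieckTopology X).WEqualsLocallyBijective (ModuleCat.{u} k) := by
  have : EssentiallySmall.{u} (Opens X) := essentiallySmall_of_small_of_locallySmall _
  have : HasSheafify ((equivSmallModel.{u} (Opens X)).inverse.inducedTopology
    (Opens.grothendieckTopology X)) (ModuleCat.{u} k) := inferInstance
  exact GrothendieckTopology.WEqualsLocallyBijective.ofEssentiallySmall.{_, _, _, _, u} _

variable {k} {X : Type} [TopologicalSpace X] (V : ModuleCat.{u} k)

/-- The section over `U` of the constant sheaf defined by a vector. -/
def constSection (U : Opens (TopCat.of X)) : V →ₗ[k] (constSheaf X V).obj.obj (op U) :=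
  ((toSheafify (Opens.grothendieckTopology (TopCat.of X))
    ((Functor.const (Opens (TopCat.of X))ᵒᵖ).obj V)).app (op U)).hom

theorem res_constSection {U W : Opens (TopCat.of X)} (h : W ≤ U) (v : V) :
    res (constSheaf X V) h (constSection V U v) = constSection V W v :=
  (congrArg (fun f => f.hom v) ((toSheafify (Opens.grothendieckTopology (TopCat.of X))
    ((Functor.const (Opens (TopCat.of X))ᵒᵖ).obj V)).naturality (homOfLE h).op)).symm

theorem constSection_injective {U : Opens (TopCat.of X)} {x : X} (hx : x ∈ U) :
    Function.Injective (constSection V U) := by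
  intro v w h
  have := wEqualsLocallyBijective k (TopCat.of X)
  have := ((Opens.grothendieckTopology (TopCat.of X)).W_toSheafify
    ((Functor.const (Opens (TopCat.of X))ᵒᵖ).obj V)).isLocallyInjective
  obtain ⟨W, i, hi, -⟩ := Presheaf.equalizerSieve_mem (Opens.grothendieckTopology (TopCat.of X))
    (toSheafify (Opens.grothendieckTopology (TopCat.of X))
      ((Functor.const (Opens (TopCat.of X))ᵒᵖ).obj V)) (X := op U) v w h x hx
  exact hi

theorem exists_res_eq_constSection {U : Opens (TopCat.of X)} (s : (constSheaf X V).obj.obj (op U))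
    {x : X} (hx : x ∈ U) : ∃ (W : Opens (TopCat.of X)) (hW : W ≤ U) (v : V), x ∈ W ∧
      res (constSheaf X V) hW s = constSection V W v := by
  have := wEqualsLocallyBijective k (TopCat.of X)
  have := ((Opens.grothendieckTopology (TopCat.of X)).W_toSheafify
    ((Functor.const (Opens (TopCat.of X))ᵒᵖ).obj V)).isLocallySurjective
  obtain ⟨W, i, ⟨v, hv⟩, hxW⟩ := Presheaf.imageSieve_mem
    (Opens.grothendieckTopology (TopCat.of X))
    (toSheafify (Opens.grothendieckTopology (TopCat.of X))
      ((Functor.const (Opens (TopCat.of X))ᵒᵖ).obj V)) (U := op U) s x hx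
  exact ⟨W, i.le, v, hxW, hv.symm⟩

/-- Locally a section is given by a vector; by injectivity on overlaps this vector is locally
constant in the point, hence constant on a connected set. -/
theorem constSection_surjective {U : Opens (TopCat.of X)} (hU : IsPreconnected (U : Set X))
    {x : X} (hx : x ∈ U) : Function.Surjective (constSection V U) := by
  intro s
  choose W hW v hxW hv using fun y : U => exists_res_eq_constSection V s y.2
  have hlc : IsLocallyConstant v := by
    rw [IsLocallyConstant.iff_exists_open]
    refine fun y => ⟨Subtype.val ⁻¹' (W y : Set X), (W y).isOpen.preimage continuous_subtype_val,
      hxW y, fun z hz => ?_⟩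
    have hz' : z.1 ∈ W z ⊓ W y := ⟨hxW z, hz⟩
    apply constSection_injective V hz'
    rw [← res_constSection V (inf_le_left : W z ⊓ W y ≤ W z),
      ← res_constSection V (inf_le_right : W z ⊓ W y ≤ W y), ← hv, ← hv, res_res, res_res]
  have : PreconnectedSpace U := Subtype.preconnectedSpace hU
  refine ⟨v ⟨x, hx⟩, eq_of_locally_res_eq _ _ _ fun y hy => ⟨W ⟨y, hy⟩, hW _, hxW ⟨y, hy⟩, ?_⟩⟩
  rw [res_constSection, hv, hlc.apply_eq_of_preconnectedSpace ⟨x, hx⟩ ⟨y, hy⟩]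

theorem IsConstantOfFiniteRank.finite {G : Sh k X} (hG : IsConstantOfFiniteRank G)
    {U : Opens (TopCat.of X)} (hU : IsPreconnected (U : Set X)) {x : X} (hx : x ∈ U) :
    Module.Finite k (G.obj.obj (op U)) := by
  obtain ⟨V, hV, ⟨e⟩⟩ := hG
  have h1 := Module.Finite.of_surjective _ (constSection_surjective V hU hx)
  let e' : G.obj.obj (op U) ≅ (constSheaf X V).obj.obj (op U) :=
    ((sheafToPresheaf _ _).mapIso e).app (op U)
  exact Module.Finite.equiv e'.toLinearEquiv.symm

theorem IsConstantOfFiniteRank.bijective_res {G : Sh k X} (hG : IsConstantOfFiniteRank G)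
    {U W : Opens (TopCat.of X)} (h : W ≤ U) (hU : IsPreconnected (U : Set X))
    (hW : IsPreconnected (W : Set X)) {x : X} (hx : x ∈ W) :
    Function.Bijective (res G h) := by
  obtain ⟨V, -, ⟨e⟩⟩ := hG
  let e' (U : Opens (TopCat.of X)) : G.obj.obj (op U) ≅ (constSheaf X V).obj.obj (op U) :=
    ((sheafToPresheaf _ _).mapIso e).app (op U)
  have hc : Function.Bijective (res (constSheaf X V) h) := by
    have h2 := constSection_injective V hx
    have h3 := constSection_surjective V hW hx
    have h4 := constSection_surjective V hU (h hx)
    have h5 : ⇑(res (constSheaf X V) h) ∘ constSection V U = constSection V W :=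
      funext fun v => res_constSection V h v
    rw [← h5] at h2 h3
    refine ⟨?_, h3.of_comp⟩
    intro s t hst
    obtain ⟨v, rfl⟩ := h4 s
    obtain ⟨w, rfl⟩ := h4 t
    exact congrArg _ (h2 hst)
  have h6 : ⇑(e' W).toLinearEquiv ∘ res G h = res (constSheaf X V) h ∘ (e' U).toLinearEquiv :=
    funext fun s => hom_res e.hom h s
  have h7 : Function.Bijective (⇑(e' W).toLinearEquiv ∘ res G h) := by
    rw [h6]
    exact hc.comp (e' U).toLinearEquiv.bijective
  exact (Function.Bijective.of_comp_iff' (e' W).toLinearEquiv.bijective _).1 h7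

end Constant

/-! ### Inverse images -/

section InverseImage

variable (k : Type u) [Field k] {X Y : TopCat.{0}} (f : X ⟶ Y)

/-- The inverse image is left adjoint to the direct image. -/
def inverseImageAdjunction :
    inverseImage k f ⊣ TopCat.Sheaf.pushforward (ModuleCat.{u} k) f :=
  (Opens.map f).sheafAdjunctionContinuous (ModuleCat.{u} k)
    (Opens.grothendieckTopology Y) (Opens.grothendieckTopology X)

variable {f}

/-- The inverse image under an open embedding, given by the sections over open subsets of the
source. -/
def naiveInverseImage (hf : IsOpenEmbedding f) :
    TopCat.Sheaf (ModuleCat.{u} k) Y ⥤ TopCat.Sheaf (ModuleCat.{u} k) X :=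
  haveI := hf.functor_isContinuous
  hf.isOpenMap.functor.sheafPushforwardContinuous (ModuleCat.{u} k)
    (Opens.grothendieckTopology X) (Opens.grothendieckTopology Y)

/-- The inverse image under an open embedding is the naive one. -/
def inverseImageIsoNaive (hf : IsOpenEmbedding f) :
    inverseImage k f ≅ naiveInverseImage k hf :=
  haveI := hf.functor_isContinuous
  -- Both functors are left adjoint to the direct image.
  (inverseImageAdjunction k f).leftAdjointUniq
    (hf.isOpenMap.adjunction.sheafPushforwardContinuous
      (E := ModuleCat.{u} k) (Opens.grothendieckTopology X) (Opens.grothendieckTopology Y))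

end InverseImage

/-! ### Restriction to open subsets -/

section OpenRestriction

variable {k : Type u} [Field k] (F : Sh k ℝ) {S : Set ℝ}

theorem isOpenEmbedding_incl (hS : IsOpen S) : IsOpenEmbedding (incl S) :=
  hS.isOpenEmbedding_subtypeVal

/-- The restriction of `F` to an open subset, given by the sections of `F` over its open subsets. -/
def openRestrict (hS : IsOpen S) : Sh k S :=
  (naiveInverseImage k (isOpenEmbedding_incl hS)).obj F

theorem exists_functor_obj_eq (hS : IsOpen S) {U : Opens (TopCat.of ℝ)} (hU : (U : Set ℝ) ⊆ S)
    (hc : _root_.IsPreconnected (U : Set ℝ)) :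
    ∃ U' : Opens (TopCat.of S), _root_.IsPreconnected (U' : Set S) ∧
      (isOpenEmbedding_incl hS).isOpenMap.functor.obj U' = U := by
  have himg : Subtype.val '' (Subtype.val ⁻¹' (U : Set ℝ) : Set S) = U := by
    rw [Subtype.image_preimage_coe, Set.inter_eq_right.2 hU]
  refine ⟨⟨Subtype.val ⁻¹' (U : Set ℝ), U.isOpen.preimage continuous_subtype_val⟩, ?_,
    Opens.ext himg⟩
  refine hS.isOpenEmbedding_subtypeVal.isInducing.isPreconnected_image.1 ?_
  exact himg.symm ▸ hc

variable {F}

theorem IsConstantOfFiniteRank.openRestrict (hS : IsOpen S)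
    (hF : IsConstantOfFiniteRank (restrict F S)) : IsConstantOfFiniteRank (openRestrict F hS) := by
  obtain ⟨V, hV, ⟨e⟩⟩ := hF
  exact ⟨V, hV, ⟨((inverseImageIsoNaive k (isOpenEmbedding_incl hS)).app F).symm ≪≫ e⟩⟩

theorem bijective_res_of_restrict (hS : IsOpen S) (hF : IsConstantOfFiniteRank (restrict F S))
    {U W : Opens (TopCat.of ℝ)} (h : W ≤ U) (hUS : (U : Set ℝ) ⊆ S)
    (hU : _root_.IsPreconnected (U : Set ℝ)) (hW : _root_.IsPreconnected (W : Set ℝ))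
    {x : ℝ} (hx : x ∈ W) :
    Function.Bijective (res F h) := by
  obtain ⟨U', hU', rfl⟩ := exists_functor_obj_eq hS hUS hU
  obtain ⟨W', hW', rfl⟩ := exists_functor_obj_eq hS (Set.Subset.trans h hUS) hW
  obtain ⟨y, hy, rfl⟩ := id hx
  refine (hF.openRestrict hS).bijective_res (U := U') (W := W') ?_ hU' hW' hy
  intro z hz
  obtain ⟨z', hz', h'⟩ := h ⟨z, hz, rfl⟩
  rwa [← Subtype.ext h']

theorem finite_of_restrict (hS : IsOpen S) (hF : IsConstantOfFiniteRank (restrict F S))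
    {U : Opens (TopCat.of ℝ)} (hUS : (U : Set ℝ) ⊆ S)
    (hU : _root_.IsPreconnected (U : Set ℝ)) {x : ℝ} (hx : x ∈ U) :
    Module.Finite k (F.obj.obj (op U)) := by
  obtain ⟨U', hU', rfl⟩ := exists_functor_obj_eq hS hUS hU
  obtain ⟨y, hy, rfl⟩ := id hx
  exact (hF.openRestrict hS).finite hU' hy

end OpenRestriction

/-! ### Germs

If the sections of `F` over arbitrarily small neighbourhoods of `t` are the sections over `U`, then
`F(U)` is the stalk of `F` at `t`. -/

section Germ

variable {k : Type u} [Field k] {X : TopCat.{0}} (F : TopCat.Sheaf (ModuleCat.{u} k) X)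

/-- `F(U)` is canonically isomorphic to the sections of `F` over arbitrarily small
neighbourhoods of `t`. -/
structure IsStar (U : Opens X) (t : X) : Prop where
  mem : t ∈ U
  exists_le : ∀ W : Opens X, t ∈ W → ∃ W' ≤ W, ∃ h : W' ≤ U, t ∈ W' ∧ Function.Bijective (res F h)

variable {F} {U : Opens X} {t : X} (hU : IsStar F U t)

/-- The germ at `t` of a section, as an element of `F(U)`. -/
def germ (W : Opens X) (hW : t ∈ W) : F.obj.obj (op W) →ₗ[k] F.obj.obj (op U) :=
  (LinearEquiv.ofBijective _ (hU.exists_le W hW).choose_spec.2.choose_spec.2).symm.toLinearMap ∘ₗ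
    res F (hU.exists_le W hW).choose_spec.1

theorem exists_res_germ (W : Opens X) (hW : t ∈ W) (s : F.obj.obj (op W)) :
    ∃ (W' : Opens X) (h : W' ≤ W) (h' : W' ≤ U), t ∈ W' ∧ res F h' (germ hU W hW s) = res F h s :=
  ⟨_, (hU.exists_le W hW).choose_spec.1, (hU.exists_le W hW).choose_spec.2.choose,
    (hU.exists_le W hW).choose_spec.2.choose_spec.1,
    (LinearEquiv.ofBijective _ (hU.exists_le W hW).choose_spec.2.choose_spec.2).apply_symm_apply _⟩

theorem germ_eq {W : Opens X} (hW : t ∈ W) (s : F.obj.obj (op W)) (σ : F.obj.obj (op U))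
    {V : Opens X} (hV : t ∈ V) (h : V ≤ W) (h' : V ≤ U) (hs : res F h s = res F h' σ) :
    germ hU W hW s = σ := by
  obtain ⟨W₁, h₁, h₁', ht₁, hs₁⟩ := exists_res_germ hU W hW s
  obtain ⟨W₂, h₂, h₂', ht₂, hinj, -⟩ := hU.exists_le (V ⊓ W₁) ⟨hV, ht₁⟩
  apply hinj
  have e₁ := congrArg (res F (h₂.trans inf_le_right)) hs₁
  have e₂ := congrArg (res F (h₂.trans inf_le_left)) hs
  rw [res_res, res_res] at e₁ e₂
  exact e₁.trans e₂

theorem germ_res {V W : Opens X} (hV : t ∈ V) (h : V ≤ W) (s : F.obj.obj (op W)) :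
    germ hU V hV (res F h s) = germ hU W (h hV) s := by
  obtain ⟨W₁, h₁, h₁', ht₁, hs₁⟩ := exists_res_germ hU V hV (res F h s)
  refine (germ_eq hU _ s _ ht₁ (h₁.trans h) h₁' ?_).symm
  rw [hs₁, res_res]

theorem germ_self (s : F.obj.obj (op U)) : germ hU U hU.mem s = s :=
  germ_eq hU _ _ _ hU.mem le_rfl le_rfl rfl

end Germ

/-! ### Restriction to a point -/

section Point

variable {k : Type u} [Field k]

/-- The presheaf of all functions with values in `E`. -/
def functionPresheaf (X : TopCat.{0}) (E : Type u) [AddCommGroup E] [Module k E] :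
    TopCat.Presheaf (ModuleCat.{u} k) X where
  obj U := ModuleCat.of k (U.unop → E)
  map i := ModuleCat.ofHom (LinearMap.funLeft k E fun x => ⟨x.1, i.unop.le x.2⟩)

/-- The sheaf of all functions with values in `E`. -/
def functionSheaf (X : TopCat.{0}) (E : Type u) [AddCommGroup E] [Module k E] :
    TopCat.Sheaf (ModuleCat.{u} k) X :=
  ⟨functionPresheaf X E, (TopCat.Presheaf.isSheaf_iff_isSheaf_comp' (forget (ModuleCat.{u} k))
    (functionPresheaf X E)).2 (TopCat.Presheaf.toTypes_isSheaf X fun _ => E)⟩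

variable {F : Sh k ℝ} {U : Opens (TopCat.of ℝ)} {t : ℝ}

/-- The germ at `t`, as a morphism to a sheaf supported at `t`. -/
def germHom (hU : IsStar F U t) : F ⟶ (TopCat.Sheaf.pushforward (ModuleCat.{u} k) (incl {t})).obj
    (functionSheaf (TopCat.of ({t} : Set ℝ)) (F.obj.obj (op U))) where
  hom :=
    { app := fun W => ModuleCat.ofHom (LinearMap.pi fun y : (Opens.map (incl {t})).obj W.unop =>
        germ hU W.unop (by have := y.2; rwa [← Set.mem_singleton_iff.1 y.1.2]))
      naturality := fun V W i => by
        ext s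
        funext y
        have ht : t ∈ W.unop := by have := y.2; rwa [← Set.mem_singleton_iff.1 y.1.2]
        exact germ_res hU ht i.unop.le s }

/-- The restriction to a point is known only as a left adjoint. The germ map to a sheaf supported at
`t` therefore factors through the unit of the adjunction. On `F(U)` the germ map is the identity, so
the unit is injective there, and its target is finite dimensional. -/
theorem finite_of_restrict_singleton (hU : IsStar F U t)
    (hF : IsConstantOfFiniteRank (restrict F {t})) : Module.Finite k (F.obj.obj (op U)) := by
  let adj := inverseImageAdjunction k (incl {t})
  let β := (adj.homEquiv _ _).symm (germHom hU)
  have h : adj.unit.app F ≫ (TopCat.Sheaf.pushforward (ModuleCat.{u} k) (incl {t})).map β =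
      germHom hU := (adj.homEquiv_unit _ _ _).symm.trans
    ((adj.homEquiv _ _).apply_symm_apply (germHom hU))
  have hfin : Module.Finite k ((restrict F {t}).obj.obj (op ((Opens.map (incl {t})).obj U))) :=
    hF.finite (x := ⟨t, rfl⟩) (Set.subsingleton_of_subsingleton).isPreconnected hU.mem
  have hinj : Function.Injective ((adj.unit.app F).hom.app (op U)).hom := by
    intro s s' hs
    have h1 : ∀ s, ((germHom hU).hom.app (op U)).hom s =
        (β.hom.app (op ((Opens.map (incl {t})).obj U))).hom
          (((adj.unit.app F).hom.app (op U)).hom s) := fun s =>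
      congrArg (fun f => (f.hom.app (op U)).hom s) h.symm
    have h2 : ((germHom hU).hom.app (op U)).hom s = ((germHom hU).hom.app (op U)).hom s' := by
      rw [h1, h1, hs]
    have h3 := congrFun h2 ⟨⟨t, rfl⟩, hU.mem⟩
    change germ hU U hU.mem s = germ hU U hU.mem s' at h3
    rwa [germ_self, germ_self] at h3
  let η : F.obj.obj (op U) →ₗ[k] (restrict F {t}).obj.obj (op ((Opens.map (incl {t})).obj U)) :=
    ((adj.unit.app F).hom.app (op U)).hom
  exact FiniteDimensional.of_injective η hinj

end Point

/-! ### Zigzags of vector spaces -/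

section Zigzag

open Module

theorem exists_functional_of_notMem {k E : Type*} [Field k] [AddCommGroup E] [Module k E]
    {A : Submodule k E} {x : E} (hx : x ∉ A) :
    ∃ φ : E →ₗ[k] k, φ x = 1 ∧ ∀ a ∈ A, φ a = 0 := by
  obtain ⟨φ, hφ, hA⟩ := Submodule.exists_le_ker_of_notMem hx
  exact ⟨(φ x)⁻¹ • φ, by simp [hφ], fun a ha => by simp [LinearMap.mem_ker.1 (hA ha)]⟩

/-- The values of `ψ` are prescribed on the image of `R` and on `A`. The hypothesis says that the
prescriptions agree, that is, that `q` kills the kernel of `L`; over a field `q` then factors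
through `L`. -/
theorem exists_functional_of_relation {k E E' : Type*} [Field k] [AddCommGroup E] [Module k E]
    [AddCommGroup E'] [Module k E'] (R : Submodule k (E × E')) (φ : E →ₗ[k] k)
    (A : Submodule k E') (h : ∀ u v, (u, v) ∈ R → v ∈ A → φ u = 0) :
    ∃ ψ : E' →ₗ[k] k, (∀ u v, (u, v) ∈ R → φ u = ψ v) ∧ ∀ a ∈ A, ψ a = 0 := by
  let L : (R × A) →ₗ[k] E' := (LinearMap.snd k E E' ∘ₗ R.subtype).coprod A.subtype
  let q : (R × A) →ₗ[k] k := (φ ∘ₗ LinearMap.fst k E E' ∘ₗ R.subtype).coprod 0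
  have hq : q ∈ LinearMap.range L.dualMap := by
    rw [LinearMap.range_dualMap_eq_dualAnnihilator_ker, Submodule.mem_dualAnnihilator]
    rintro ⟨⟨⟨u, v⟩, hR⟩, a⟩ hL
    have hL' : v + a = 0 := hL
    have : φ u = 0 := h u v hR (by rw [eq_neg_of_add_eq_zero_left hL']; exact A.neg_mem a.2)
    simpa [q] using this
  obtain ⟨ψ, hψ⟩ := hq
  refine ⟨ψ, fun u v hR => ?_, fun a ha => ?_⟩
  · have := LinearMap.congr_fun hψ (⟨(u, v), hR⟩, 0)
    simpa [L, q] using this.symm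
  · have := LinearMap.congr_fun hψ (0, ⟨a, ha⟩)
    simpa [L, q] using this

variable {k : Type u} [Field k] {V : ℕ → Type v} [∀ i, AddCommGroup (V i)] [∀ i, Module k (V i)]
  (p : ℕ → Prop) (f : ∀ i, V i →ₗ[k] V (i + 1)) (g : ∀ i, V (i + 1) →ₗ[k] V i)

open Classical in
/-- The linear relation between two consecutive spaces of a zigzag: the graph of `f i` or of `g i`,
according to whether `p i` holds. -/
def linkRel (i : ℕ) : Submodule k (V i × V (i + 1)) :=
  if p i then LinearMap.ker ((f i).coprod (-LinearMap.id))
  else LinearMap.ker ((-LinearMap.id).coprod (g i))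

variable {p f g}

theorem mem_linkRel_of_pos {i : ℕ} (hp : p i) (x : V i) (y : V (i + 1)) :
    (x, y) ∈ linkRel p f g i ↔ f i x = y := by
  simp [linkRel, hp, ← sub_eq_add_neg, sub_eq_zero]

theorem mem_linkRel_of_neg {i : ℕ} (hp : ¬ p i) (x : V i) (y : V (i + 1)) :
    (x, y) ∈ linkRel p f g i ↔ g i y = x := by
  simp [linkRel, hp, neg_add_eq_sub, sub_eq_zero]

variable (p f g)

/-- A compatible family of vectors and a compatible family of functionals on the spaces with index
in `[b, N]` of a zigzag. -/
structure IsBar (b N : ℕ) (x : ∀ i, V i) (φ : ∀ i, V i →ₗ[k] k) : Prop where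
  le : b ≤ N
  vec : ∀ i, b ≤ i → i < N → (x i, x (i + 1)) ∈ linkRel p f g i
  functional : ∀ i, b ≤ i → i < N → ∀ u v, (u, v) ∈ linkRel p f g i → φ i u = φ (i + 1) v
  -- One of the two families must extend by zero to the left of `b`. Since the pairing is nonzero at
  -- `b`, the first case can occur only for an arrow pointing left and the second only for an arrow
  -- pointing right, and these are the cases in which the condition is needed for a splitting.
  boundary : ∀ i, i + 1 = b → (0, x (i + 1)) ∈ linkRel p f g i ∨
    ∀ u v, (u, v) ∈ linkRel p f g i → φ (i + 1) v = 0
  pairing : φ N (x N) = 1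

/-- The pair `A ≤ B` records the constraints imposed from the right on the last vector and the last
functional. It makes the induction work: to extend a bar from `N` to `N + 1`, both subspaces are
pulled back along the linear relation. -/
theorem exists_isBar (N : ℕ) : ∀ (A B : Submodule k (V N)) (y : V N), A ≤ B → y ∈ B → y ∉ A →
    ∃ b x φ, IsBar p f g b N x φ ∧ x N ∈ B ∧ ∀ a ∈ A, φ N a = 0 := by
  induction N with
  | zero =>
    intro A B y hAB hB hA
    obtain ⟨ψ, h1, h2⟩ := exists_functional_of_notMem hA
    refine ⟨0, Function.update 0 0 y, Function.update 0 0 ψ, ⟨le_rfl, ?_, ?_, ?_, ?_⟩, ?_, ?_⟩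
    · intro i _ hi; omega
    · intro i _ hi; omega
    · intro i hi; omega
    · simpa using h1
    · simpa using hB
    · simpa using h2
  | succ N ih =>
    intro A B y hAB hB hA
    -- If an admissible vector is related to 0, the bar can start here, with the vectors extended by
    -- zero to the left.
    by_cases hK : ∃ z ∈ B, z ∉ A ∧ (0, z) ∈ linkRel p f g N
    · obtain ⟨z, hzB, hzA, hz⟩ := hK
      obtain ⟨ψ, h1, h2⟩ := exists_functional_of_notMem hzA
      refine ⟨N + 1, Function.update 0 (N + 1) z, Function.update 0 (N + 1) ψ,
        ⟨le_rfl, ?_, ?_, ?_, ?_⟩, ?_, ?_⟩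
      · intro i _ hi; omega
      · intro i _ hi; omega
      · intro i hi
        obtain rfl : i = N := by omega
        left
        simpa using hz
      · simpa using h1
      · simpa using hzB
      · simpa using h2
    push Not at hK
    let I : Submodule k (V (N + 1)) := (linkRel p f g N).map (LinearMap.snd k _ _)
    -- Otherwise the question is whether `y` has a partner on the left modulo `A`. If so, the bar is
    -- continued to the left; if not, a functional vanishing on `A ⊔ I` lets it start here.
    by_cases hI : y ∈ A ⊔ I
    · have hI' : ∃ y' ∈ B, y' ∉ A ∧ ∃ u, (u, y') ∈ linkRel p f g N := by
        obtain ⟨a, ha, y', ⟨⟨u, v⟩, hR, rfl⟩, rfl⟩ := Submodule.mem_sup.1 hI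
        refine ⟨v, ?_, fun hv => hA (A.add_mem ha hv), u, hR⟩
        simpa using B.sub_mem hB (hAB ha)
      clear! y
      obtain ⟨y, hB, hA, u, hu⟩ := hI'
      let pull (C : Submodule k (V (N + 1))) : Submodule k (V N) :=
        (linkRel p f g N ⊓ C.comap (LinearMap.snd k _ _)).map (LinearMap.fst k _ _)
      have hpull : ∀ C u, u ∈ pull C ↔ ∃ v ∈ C, (u, v) ∈ linkRel p f g N := by
        intro C u
        constructor
        · rintro ⟨⟨u, v⟩, ⟨h1, h2⟩, rfl⟩
          exact ⟨v, h2, h1⟩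
        · rintro ⟨v, h2, h1⟩
          exact ⟨(u, v), ⟨h1, h2⟩, rfl⟩
      obtain ⟨b, x, φ, hbar, hx, hφ⟩ := ih (pull A) (pull B) u
        (Submodule.map_mono (inf_le_inf le_rfl (Submodule.comap_mono hAB)))
        ((hpull _ _).2 ⟨y, hB, hu⟩) (by
          rw [hpull]
          -- Two partners of `u` differ by a vector related to 0, and `hK` forces such a vector of
          -- `B` into `A`; then `y` would lie in `A`.
          rintro ⟨v, hv, huv⟩
          have h0 := (linkRel p f g N).sub_mem hu huv
          simp only [Prod.mk_sub_mk, sub_self] at h0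
          by_contra
          refine hK (y - v) (B.sub_mem hB (hAB hv)) ?_ h0
          intro h
          apply hA
          simpa using A.add_mem h hv)
      obtain ⟨z, hzB, hz⟩ := (hpull _ _).1 hx
      obtain ⟨ψ, h1, h2⟩ := exists_functional_of_relation (linkRel p f g N) (φ N) A
        (fun u v huv hv => hφ u ((hpull _ _).2 ⟨v, hv, huv⟩))
      have hne : ∀ i, i ≤ N → i ≠ N + 1 := fun i hi => by omega
      refine ⟨b, Function.update x (N + 1) z, Function.update φ (N + 1) ψ,
        ⟨hbar.le.trans (Nat.le_succ N), ?_, ?_, ?_, ?_⟩, ?_, ?_⟩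
      · intro i hbi hi
        rw [Function.update_of_ne (hne i (by omega))]
        rcases Nat.lt_succ_iff_lt_or_eq.1 hi with hi | rfl
        · rw [Function.update_of_ne (hne (i + 1) (by omega))]
          exact hbar.vec i hbi hi
        · simpa using hz
      · intro i hbi hi
        rw [Function.update_of_ne (hne i (by omega))]
        rcases Nat.lt_succ_iff_lt_or_eq.1 hi with hi | rfl
        · rw [Function.update_of_ne (hne (i + 1) (by omega))]
          exact hbar.functional i hbi hi
        · simpa using h1
      · intro i hi
        have := hbar.le
        rw [Function.update_of_ne (hne (i + 1) (by omega)),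
          Function.update_of_ne (hne (i + 1) (by omega))]
        exact hbar.boundary i hi
      · simp only [Function.update_self]
        rw [← h1 _ _ hz, hbar.pairing]
      · simpa using hzB
      · simpa using h2
    · obtain ⟨ψ, h1, h2⟩ := exists_functional_of_notMem hI
      refine ⟨N + 1, Function.update 0 (N + 1) y, Function.update 0 (N + 1) ψ,
        ⟨le_rfl, ?_, ?_, ?_, ?_⟩, ?_, ?_⟩
      · intro i _ hi; omega
      · intro i _ hi; omega
      · intro i hi
        obtain rfl : i = N := by omega
        right
        intro u v huv
        simpa using h2 v (Submodule.mem_sup_right ⟨(u, v), huv, rfl⟩)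
      · simpa using h1
      · simpa using hB
      · simpa using fun a ha => h2 a (Submodule.mem_sup_left ha)

variable {p f g} in
theorem IsBar.pairing_eq_one {b N : ℕ} {x : ∀ i, V i} {φ : ∀ i, V i →ₗ[k] k}
    (h : IsBar p f g b N x φ) {i : ℕ} (hb : b ≤ i) (hN : i ≤ N) : φ i (x i) = 1 := by
  induction hN using Nat.decreasingInduction with
  | self => exact h.pairing
  | of_succ i hi ih => rw [h.functional i hb hi _ _ (h.vec i hb hi), ih (by omega)]

/-- A decomposition of a zigzag into intervals, in terms of functionals. -/
structure IsBarcode {A : Type} (b d : A → ℕ) (φ : A → ∀ i, V i →ₗ[k] k) : Prop where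
  le : ∀ a, b a ≤ d a
  eq_zero : ∀ a i, ¬ (b a ≤ i ∧ i ≤ d a) → φ a i = 0
  -- Compatibility is required only if the target of the arrow lies in the bar. The source may lie
  -- outside, and then the right-hand side is zero.
  comp_f : ∀ a i, p i → b a ≤ i + 1 → i + 1 ≤ d a → ∀ u, φ a (i + 1) (f i u) = φ a i u
  comp_g : ∀ a i, ¬ p i → b a ≤ i → i ≤ d a → ∀ v, φ a i (g i v) = φ a (i + 1) v
  injective : ∀ i u, (∀ a, φ a i u = 0) → u = 0
  surjective : ∀ i (c : A → k), (∀ a, ¬ (b a ≤ i ∧ i ≤ d a) → c a = 0) → ∃ u, ∀ a, φ a i u = c a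

/-- Induction on the total dimension. A bar with vectors `x` and functionals `φ` is a direct summand
with complement `ker φ`, so the zigzag itself has to vary in the induction. -/
theorem exists_isBarcode_aux (N : ℕ) (n : ℕ) : ∀ {V : ℕ → Type v} [∀ i, AddCommGroup (V i)]
    [∀ i, Module k (V i)] (f : ∀ i, V i →ₗ[k] V (i + 1)) (g : ∀ i, V (i + 1) →ₗ[k] V i)
    [∀ i, Module.Finite k (V i)] (_ : ∀ i, N < i → Subsingleton (V i))
    (_ : ∑ i ∈ Finset.range (N + 1), finrank k (V i) = n),
    ∃ (A : Type) (_ : Finite A) (b d : A → ℕ) (φ : A → ∀ i, V i →ₗ[k] k),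
      IsBarcode p f g b d φ := by
  induction n using Nat.strong_induction_on with
  | _ n ih =>
  intro V _ _ f g _ hV hn
  by_cases hz : ∀ i, Subsingleton (V i)
  · refine ⟨Empty, inferInstance, Empty.elim, Empty.elim, fun a => a.elim, fun a => a.elim,
      fun a => a.elim, fun a => a.elim, fun a => a.elim, fun i u _ => Subsingleton.elim _ _,
      fun i c _ => ⟨0, fun a => a.elim⟩⟩
  push Not at hz
  -- The bar ends at the last nonzero space, so that nothing has to be checked at its right end.
  obtain ⟨M, hMN, hM, hMmax⟩ : ∃ M ≤ N, Nontrivial (V M) ∧ ∀ i, M < i → Subsingleton (V i) := by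
    classical
    obtain ⟨i, hi⟩ := hz
    have hle : ∀ i, Nontrivial (V i) → i ≤ N := fun i hi => by
      by_contra h
      have := hV i (by omega)
      exact false_of_nontrivial_of_subsingleton (V i)
    refine ⟨Nat.findGreatest (fun i => Nontrivial (V i)) N, Nat.findGreatest_le N,
      Nat.findGreatest_spec (P := fun i => Nontrivial (V i)) (hle i hi) hi, fun j hj => ?_⟩
    by_contra h
    rw [not_subsingleton_iff_nontrivial] at h
    exact Nat.findGreatest_is_greatest hj (hle j h) h
  obtain ⟨y, hy⟩ := exists_ne (0 : V M)
  obtain ⟨b, x₀, φ₀, hbar, -, -⟩ := exists_isBar p f g M ⊥ ⊤ y bot_le trivial (by simpa using hy)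
  classical
  let x : ∀ i, V i := fun i => if b ≤ i ∧ i ≤ M then x₀ i else 0
  let φ : ∀ i, V i →ₗ[k] k := fun i => if b ≤ i ∧ i ≤ M then φ₀ i else 0
  have hφ0 : ∀ i, ¬ (b ≤ i ∧ i ≤ M) → φ i = 0 := fun i hi => if_neg hi
  have hx0 : ∀ i, ¬ (b ≤ i ∧ i ≤ M) → x i = 0 := fun i hi => if_neg hi
  have hφx : ∀ i, (b ≤ i ∧ i ≤ M) → φ i (x i) = 1 := fun i hi => by
    simp only [x, φ, if_pos hi]
    exact hbar.pairing_eq_one hi.1 hi.2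
  have hφf : ∀ i, p i → b ≤ i + 1 → i + 1 ≤ M → ∀ u, φ (i + 1) (f i u) = φ i u := by
    intro i hp h1 h2 u
    rcases Nat.lt_or_ge i b with hi | hi
    · rw [hφ0 i (by omega)]
      simp only [φ, if_pos (And.intro h1 h2)]
      rcases hbar.boundary i (by omega) with h | h
      · rw [mem_linkRel_of_pos hp, map_zero] at h
        have := hbar.pairing_eq_one h1 h2
        rw [← h, map_zero] at this
        exact (zero_ne_one this).elim
      · exact h u _ ((mem_linkRel_of_pos hp _ _).2 rfl)
    · simp only [φ, if_pos (And.intro h1 h2), if_pos (show b ≤ i ∧ i ≤ M by omega)]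
      exact (hbar.functional i hi h2 _ _ ((mem_linkRel_of_pos hp _ _).2 rfl)).symm
  have hφg : ∀ i, ¬ p i → b ≤ i → i ≤ M → ∀ v, φ i (g i v) = φ (i + 1) v := by
    intro i hp h1 h2 v
    rcases h2.lt_or_eq with h2' | rfl
    · simp only [φ, if_pos (And.intro h1 h2), if_pos (show b ≤ i + 1 ∧ i + 1 ≤ M by omega)]
      exact hbar.functional i h1 h2' _ _ ((mem_linkRel_of_neg hp _ _).2 rfl)
    · have := hMmax (i + 1) (by omega)
      rw [Subsingleton.elim v 0]
      simp
  have hxf : ∀ i, p i → b ≤ i → i ≤ M → f i (x i) = x (i + 1) := by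
    intro i hp h1 h2
    rcases h2.lt_or_eq with h2' | rfl
    · simp only [x, if_pos (And.intro h1 h2), if_pos (show b ≤ i + 1 ∧ i + 1 ≤ M by omega)]
      exact (mem_linkRel_of_pos hp _ _).1 (hbar.vec i h1 h2')
    · have := hMmax (i + 1) (by omega)
      exact Subsingleton.elim _ _
  have hxg : ∀ i, ¬ p i → b ≤ i + 1 → i + 1 ≤ M → g i (x (i + 1)) = x i := by
    intro i hp h1 h2
    rcases Nat.lt_or_ge i b with hi | hi
    · rw [hx0 i (by omega)]
      simp only [x, if_pos (And.intro h1 h2)]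
      rcases hbar.boundary i (by omega) with h | h
      · exact (mem_linkRel_of_neg hp _ _).1 h
      · have := hbar.pairing_eq_one h1 h2
        rw [h _ _ ((mem_linkRel_of_neg hp _ _).2 rfl)] at this
        exact (zero_ne_one this).elim
    · simp only [x, if_pos (And.intro h1 h2), if_pos (show b ≤ i ∧ i ≤ M by omega)]
      exact (mem_linkRel_of_neg hp _ _).1 (hbar.vec i hi h2)
  have hφφ : ∀ i u, φ i (u - φ i u • x i) = 0 := by
    intro i u
    by_cases hi : b ≤ i ∧ i ≤ M
    · simp [hφx i hi]
    · simp [hφ0 i hi]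
  let π : ∀ i, V i →ₗ[k] LinearMap.ker (φ i) := fun i =>
    (LinearMap.id - (φ i).smulRight (x i)).codRestrict _ fun u => hφφ i u
  have hπ : ∀ i u, (π i u : V i) = u - φ i u • x i := fun i u => rfl
  have hπx : ∀ i, π i (x i) = 0 := by
    intro i
    ext
    by_cases hi : b ≤ i ∧ i ≤ M
    · simp [hπ, hφx i hi]
    · simp [hx0 i hi]
  have hπι : ∀ i (w : LinearMap.ker (φ i)), π i w = w := by
    intro i w
    ext
    rw [hπ, LinearMap.mem_ker.1 w.2]
    simp
  -- Composing with `π` gives maps between the kernels for every `i`, even where `f i` or `g i` is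
  -- not an arrow of the zigzag and need not preserve them.
  let f' : ∀ i, LinearMap.ker (φ i) →ₗ[k] LinearMap.ker (φ (i + 1)) := fun i =>
    π (i + 1) ∘ₗ f i ∘ₗ (LinearMap.ker (φ i)).subtype
  let g' : ∀ i, LinearMap.ker (φ (i + 1)) →ₗ[k] LinearMap.ker (φ i) := fun i =>
    π i ∘ₗ g i ∘ₗ (LinearMap.ker (φ (i + 1))).subtype
  have hf' : ∀ i, p i → ∀ u, f' i (π i u) = π (i + 1) (f i u) := by
    intro i hp u
    change π (i + 1) (f i (u - φ i u • x i)) = _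
    by_cases hi : b ≤ i ∧ i ≤ M
    · rw [map_sub, map_smul, hxf i hp hi.1 hi.2, map_sub, map_smul, hπx, smul_zero, sub_zero]
    · simp [hφ0 i hi]
  have hg' : ∀ i, ¬ p i → ∀ u, g' i (π (i + 1) u) = π i (g i u) := by
    intro i hp u
    change π i (g i (u - φ (i + 1) u • x (i + 1))) = _
    by_cases hi : b ≤ i + 1 ∧ i + 1 ≤ M
    · rw [map_sub, map_smul, hxg i hp hi.1 hi.2, map_sub, map_smul, hπx, smul_zero, sub_zero]
    · simp [hφ0 _ hi]
  have hlt : ∑ i ∈ Finset.range (N + 1), finrank k (LinearMap.ker (φ i)) < n := by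
    rw [← hn]
    refine Finset.sum_lt_sum (fun i _ => Submodule.finrank_le _)
      ⟨M, Finset.mem_range.2 (by omega), Submodule.finrank_lt ?_⟩
    intro htop
    have h1 := hφx M ⟨hbar.le, le_rfl⟩
    rw [LinearMap.mem_ker.1 (htop ▸ Submodule.mem_top : x M ∈ LinearMap.ker (φ M))] at h1
    exact zero_ne_one h1
  obtain ⟨A, hA, bA, dA, ψ, hψ⟩ := ih _ hlt f' g'
    (fun i hi => by have := hV i hi; infer_instance) rfl
  refine ⟨Option A, inferInstance, fun a => a.elim b bA, fun a => a.elim M dA,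
    fun a => a.elim φ fun a i => ψ a i ∘ₗ π i, ?_, ?_, ?_, ?_, ?_, ?_⟩
  · rintro (_ | a)
    exacts [hbar.le, hψ.le a]
  · rintro (_ | a) i hi
    · exact hφ0 i hi
    · change ψ a i ∘ₗ π i = 0
      rw [hψ.eq_zero a i hi, LinearMap.zero_comp]
  · rintro (_ | a) i hp h1 h2 u
    · exact hφf i hp h1 h2 u
    · change ψ a (i + 1) (π (i + 1) (f i u)) = ψ a i (π i u)
      rw [← hf' i hp, hψ.comp_f a i hp h1 h2]
  · rintro (_ | a) i hp h1 h2 u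
    · exact hφg i hp h1 h2 u
    · change ψ a i (π i (g i u)) = ψ a (i + 1) (π (i + 1) u)
      rw [← hg' i hp, hψ.comp_g a i hp h1 h2]
  · intro i u hu
    have h1 : π i u = 0 := hψ.injective i _ fun a => hu (some a)
    have h2 : φ i u = 0 := hu none
    have h3 := hπ i u
    rw [h1, h2] at h3
    simpa using h3.symm
  · intro i c hc
    obtain ⟨w, hw⟩ := hψ.surjective i (fun a => c (some a)) fun a => hc (some a)
    refine ⟨w + c none • x i, ?_⟩
    rintro (_ | a)
    · change φ i (w + c none • x i) = c none
      rw [map_add, LinearMap.mem_ker.1 w.2, zero_add, map_smul]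
      by_cases hi : b ≤ i ∧ i ≤ M
      · simp [hφx i hi]
      · simp [hc none hi]
    · change ψ a i (π i (w + c none • x i)) = c (some a)
      rw [map_add, map_smul, hπx, hπι, smul_zero, add_zero, hw]

/-- Every zigzag of finite dimensional vector spaces of finite length is a direct sum of
intervals. -/
theorem exists_isBarcode [∀ i, Module.Finite k (V i)] (N : ℕ)
    (hV : ∀ i, N < i → Subsingleton (V i)) :
    ∃ (A : Type) (_ : Finite A) (b d : A → ℕ) (φ : A → ∀ i, V i →ₗ[k] k),
      IsBarcode p f g b d φ :=
  exists_isBarcode_aux p N _ f g hV rfl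

end Zigzag

/-! ### Stratifications of `ℝ` with finitely many strata -/

/-- `j` numbers the strata of a stratification of `ℝ` from left to right: the strata of odd index
are points and those of even index are open intervals. -/
structure IsStratumIndex (j : ℝ → ℕ) : Prop where
  mono : Monotone j
  even : ∀ y, Even (j y) → ∀ᶠ z in 𝓝 y, j z = j y
  odd : ∀ y, Odd (j y) → ∀ᶠ z in 𝓝 y, (z < y → j z + 1 = j y) ∧ (y < z → j z = j y + 1)

/-- The open star of a stratum: the union of the strata whose closure meets it. -/
def starSet (j : ℝ → ℕ) (m : ℕ) : Set ℝ :=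
  -- The condition on the range makes the star of an unused index empty, so that its space of
  -- sections is zero.
  {y | m ∈ Set.range j ∧ (j y = m ∨ Odd m ∧ (j y + 1 = m ∨ j y = m + 1))}

section Star

variable {j : ℝ → ℕ} (hj : IsStratumIndex j)
include hj

theorem IsStratumIndex.isOpen_starSet (m : ℕ) : IsOpen (starSet j m) := by
  rw [isOpen_iff_eventually]
  rintro y ⟨hm, hy⟩
  rcases Nat.even_or_odd (j y) with h | h
  · filter_upwards [hj.even y h] with z hz
    exact ⟨hm, hz.symm ▸ hy⟩
  · obtain rfl : j y = m := by
      rcases hy with hy | ⟨hm, hy⟩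
      · exact hy
      · rw [Nat.odd_iff] at h hm
        omega
    filter_upwards [hj.odd y h] with z hz
    refine ⟨hm, ?_⟩
    rcases lt_trichotomy z y with h' | rfl | h'
    exacts [.inr ⟨h, .inl (hz.1 h')⟩, .inl rfl, .inr ⟨h, .inr (hz.2 h')⟩]

/-- The open star of a stratum. -/
def IsStratumIndex.star (m : ℕ) : Opens (TopCat.of ℝ) := ⟨starSet j m, hj.isOpen_starSet m⟩

theorem IsStratumIndex.mem_star {m : ℕ} {y : ℝ} : y ∈ hj.star m ↔
    m ∈ Set.range j ∧ (j y = m ∨ Odd m ∧ (j y + 1 = m ∨ j y = m + 1)) := Iff.rfl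

theorem IsStratumIndex.self_mem_star (y : ℝ) : y ∈ hj.star (j y) := ⟨⟨y, rfl⟩, .inl rfl⟩

theorem IsStratumIndex.star_le_star {m : ℕ} {y : ℝ} (hy : y ∈ hj.star m) :
    hj.star (j y) ≤ hj.star m := by
  obtain ⟨hm, h | ⟨hodd, h⟩⟩ := hj.mem_star.1 hy
  · rw [h]
  · rintro z ⟨-, hz | ⟨hodd', hz⟩⟩
    · exact ⟨hm, .inr ⟨hodd, hz.symm ▸ h⟩⟩
    · rw [Nat.odd_iff] at hodd hodd'
      omega

theorem IsStratumIndex.ordConnected_star (m : ℕ) : (hj.star m : Set ℝ).OrdConnected := by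
  refine ⟨?_⟩
  rintro x ⟨hm, hx⟩ y ⟨-, hy⟩ z hz
  have h1 := hj.mono hz.1
  have h2 := hj.mono hz.2
  refine ⟨hm, ?_⟩
  by_cases hodd : Odd m
  · simp only [hodd, true_and] at hx hy ⊢
    omega
  · simp only [hodd, false_and, or_false] at hx hy ⊢
    omega

end Star

theorem exists_ordConnected_nhds {U : Opens (TopCat.of ℝ)} {y : ℝ} (hy : y ∈ U) :
    ∃ W ≤ U, y ∈ W ∧ (W : Set ℝ).OrdConnected := by
  obtain ⟨ε, hε, h⟩ := Metric.isOpen_iff.1 U.isOpen y hy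
  refine ⟨⟨Metric.ball y ε, Metric.isOpen_ball⟩, h, Metric.mem_ball_self hε, ?_⟩
  change (Metric.ball y ε).OrdConnected
  rw [Real.ball_eq_Ioo]
  exact Set.ordConnected_Ioo

/-! ### Decomposition of sheaves adapted to a finite stratification -/

section Adapted

variable {k : Type u} [Field k] (F : Sh k ℝ) {j : ℝ → ℕ} (hj : IsStratumIndex j)

/-- The sections of `F` over the open star of a stratum are the sections over every interval in
the star that meets the stratum, and they form a finite dimensional space. -/
structure IsAdapted : Prop where
  bijective : ∀ (m : ℕ) (W : Opens (TopCat.of ℝ)) (h : W ≤ hj.star m), (W : Set ℝ).OrdConnected →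
    (∃ x ∈ W, j x = m) → Function.Bijective (res F h)
  finite : ∀ x, Module.Finite k (F.obj.obj (op (hj.star (j x))))

variable {F hj}

theorem IsAdapted.isStar (h : IsAdapted F hj) (y : ℝ) : IsStar F (hj.star (j y)) y where
  mem := hj.self_mem_star y
  exists_le W hW := by
    obtain ⟨W', hW', hy, hc⟩ := exists_ordConnected_nhds
      (show y ∈ W ⊓ hj.star (j y) from ⟨hW, hj.self_mem_star y⟩)
    exact ⟨W', hW'.trans inf_le_left, hW'.trans inf_le_right, hy,
      h.bijective _ _ _ hc ⟨y, hy, rfl⟩⟩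

open Classical in
variable (F hj) in
/-- The restriction from the star of a stratum to the star of the next one. -/
def stepRight (m : ℕ) :
    F.obj.obj (op (hj.star m)) →ₗ[k] F.obj.obj (op (hj.star (m + 1))) :=
  if h : hj.star (m + 1) ≤ hj.star m then res F h else 0

open Classical in
variable (F hj) in
/-- The restriction from the star of a stratum to the star of the previous one. -/
def stepLeft (m : ℕ) :
    F.obj.obj (op (hj.star (m + 1))) →ₗ[k] F.obj.obj (op (hj.star m)) :=
  if h : hj.star m ≤ hj.star (m + 1) then res F h else 0

/-! ### From bars of the zigzag to morphisms of sheaves -/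

section Bar

variable {A : Type} {b d : A → ℕ} {φ : A → ∀ i, F.obj.obj (op (hj.star i)) →ₗ[k] k}
  (h : IsAdapted F hj) (hbar : IsBarcode Odd (stepRight F hj) (stepLeft F hj) b d φ)

theorem germ_star (m : ℕ) (σ : F.obj.obj (op (hj.star m))) {z : ℝ} (hz : z ∈ hj.star m) :
    germ (h.isStar z) (hj.star m) hz σ = res F (hj.star_le_star hz) σ := by
  refine germ_eq _ hz _ _ (hj.self_mem_star z) (hj.star_le_star hz) le_rfl ?_
  rw [res_self]

open Classical in
include hbar in
theorem functional_germ_star (a : A) (m : ℕ) (σ : F.obj.obj (op (hj.star m))) {z : ℝ}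
    (hz : z ∈ hj.star m) : φ a (j z) (germ (h.isStar z) (hj.star m) hz σ) =
      if b a ≤ j z ∧ j z ≤ d a then φ a m σ else 0 := by
  split_ifs with hI
  · rw [germ_star h]
    have hle := hj.star_le_star hz
    suffices ∀ n (hle : hj.star n ≤ hj.star m), b a ≤ n ∧ n ≤ d a →
        (n = m ∨ Odd m ∧ (n + 1 = m ∨ n = m + 1)) → φ a n (res F hle σ) = φ a m σ from
      this _ hle hI (hj.mem_star.1 hz).2
    rintro n hle hn (rfl | ⟨hodd, rfl | rfl⟩)
    · rw [res_self]
    · rw [← hbar.comp_g a n (by rw [Nat.odd_iff] at *; omega) hn.1 hn.2]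
      rw [stepLeft, dif_pos hle]
    · rw [← hbar.comp_f a m hodd hn.1 hn.2]
      rw [stepRight, dif_pos hle]
  · rw [hbar.eq_zero a _ hI, LinearMap.zero_apply]

/-- The interval of `ℝ` defined by a bar. -/
def barInterval (j : ℝ → ℕ) (b d : ℕ) : Set ℝ := {y | b ≤ j y ∧ j y ≤ d}

-- Near `y` the function attached to `s` is a constant times the indicator of the interval of the
-- bar. The constant is the value at `y`, which is zero if `y` lies outside the interval. This gives
-- local constancy on the interval and closedness of the support at once.
open Classical in
include hbar in
theorem eventually_functional_germ (a : A) {U : Opens (TopCat.of ℝ)} (s : F.obj.obj (op U))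
    (y : U) : ∀ᶠ z : U in 𝓝 y, φ a (j z.1) (germ (h.isStar z.1) U z.2 s) =
      if z.1 ∈ barInterval j (b a) (d a) then φ a (j y.1) (germ (h.isStar y.1) U y.2 s) else 0 := by
  obtain ⟨W, hW, hW', hy, hs⟩ := exists_res_germ (h.isStar y.1) U y.2 s
  have hmem : Subtype.val ⁻¹' (W : Set ℝ) ∈ 𝓝 y :=
    (W.isOpen.preimage continuous_subtype_val).mem_nhds hy
  filter_upwards [hmem] with z hz
  rw [← germ_res (h.isStar z.1) hz hW, ← hs, germ_res, functional_germ_star h hbar]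
  exact if_congr Iff.rfl rfl rfl

include hbar in
theorem isExtSection_functional_germ (a : A) {U : Opens (TopCat.of ℝ)} (s : F.obj.obj (op U)) :
    IsExtSection (barInterval j (b a) (d a))
      fun y : U => φ a (j y.1) (germ (h.isStar y.1) U y.2 s) := by
  rw [isExtSection_iff]
  refine ⟨fun y hy => ?_, fun y hy => ?_, fun y hy => ?_⟩
  · rw [hbar.eq_zero a _ hy, LinearMap.zero_apply]
  · filter_upwards [eventually_functional_germ h hbar a s y] with z hz hzI
    rw [hz, if_pos hzI]
  · filter_upwards [eventually_functional_germ h hbar a s y] with z hz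
    rw [hz, hy, ite_self]

/-- The morphism `F ⟶ k_I` defined by a bar. -/
def barHom (a : A) : F ⟶ kSheaf k (barInterval j (b a) (d a)) where
  hom :=
    { app := fun U => ModuleCat.ofHom
        { toFun := fun s => ⟨fun y => φ a (j y.1) (germ (h.isStar y.1) U.unop y.2 s),
            isExtSection_functional_germ h hbar a s⟩
          map_add' := fun s t => by
            ext y
            simp
          map_smul' := fun c s => by
            ext y
            simp }
      naturality := fun U V i => by
        ext s
        refine Subtype.ext (funext fun y => ?_)
        exact congrArg _ (germ_res (h.isStar y.1) y.2 i.unop.le s) }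

theorem sum_biproduct_π_ι {C : Type*} [Category* C] [Preadditive C] {ι : Type v} [Fintype ι]
    (G : ι → C) [HasBiproduct G] : ∑ a, biproduct.π G a ≫ biproduct.ι G a = 𝟙 (⨁ G) := by
  classical
  refine biproduct.hom_ext' _ _ fun a => ?_
  rw [Preadditive.comp_sum, Finset.sum_eq_single a]
  · simp
  · intro b _ hb
    rw [biproduct.ι_π_ne_assoc _ hb.symm, zero_comp]
  · simp

theorem biproduct_hom_ext_apply {ι : Type v} [Finite ι] {X : Type} [TopologicalSpace X]
    (G : ι → Sh k X) (U : Opens (TopCat.of X)) (z z' : (⨁ G).obj.obj (op U))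
    (hz : ∀ a, ((biproduct.π G a).hom.app (op U)).hom z =
      ((biproduct.π G a).hom.app (op U)).hom z') :
    z = z' := by
  classical
  cases nonempty_fintype ι
  let T : (⨁ G ⟶ ⨁ G) →+ ((⨁ G).obj.obj (op U) →ₗ[k] (⨁ G).obj.obj (op U)) :=
    { toFun := fun α => (α.hom.app (op U)).hom
      map_zero' := rfl
      map_add' := fun _ _ => rfl }
  have key : ∀ z, z = ∑ a, ((biproduct.ι G a).hom.app (op U)).hom
      (((biproduct.π G a).hom.app (op U)).hom z) := by
    intro z
    have ht : ∑ a, biproduct.π G a ≫ biproduct.ι G a = 𝟙 (⨁ G) := sum_biproduct_π_ι G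
    have := congrArg (fun f => f z) (congrArg T ht)
    rw [map_sum] at this
    simp only [LinearMap.sum_apply] at this
    exact this.symm
  rw [key z, key z']
  simp only [hz]

-- A section killed by all bars has zero germs. Conversely, the values at `y` of given sections of
-- the `k_I` come from some `σ` over the star of `y`, and agreement at `y` spreads to a
-- neighbourhood.
include h hbar in
theorem isIso_lift_barHom [Finite A] : IsIso (biproduct.lift (barHom h hbar)) := by
  have hlift : ∀ a (U : Opens (TopCat.of ℝ)) (s : F.obj.obj (op U)),
      ((biproduct.π (fun a => kSheaf k (barInterval j (b a) (d a))) a).hom.app (op U)).hom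
        (((biproduct.lift (barHom h hbar)).hom.app (op U)).hom s) =
      ((barHom h hbar a).hom.app (op U)).hom s := fun a U s =>
    congrArg (fun f => (f.hom.app (op U)).hom s) (biproduct.lift_π (barHom h hbar) a)
  refine isIso_of_locally_bijective _ (fun U s hs => ?_) (fun U t y hy => ?_)
  · refine eq_of_locally_res_eq F _ _ fun y hy => ?_
    have hg : germ (h.isStar y) U hy s = 0 := by
      refine hbar.injective _ _ fun a => ?_
      have h1 := hlift a U s
      rw [hs, map_zero] at h1
      exact (congrArg (fun g => g.1 ⟨y, hy⟩) h1).symm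
    obtain ⟨W, hW, hW', hyW, hs'⟩ := exists_res_germ (h.isStar y) U hy s
    refine ⟨W, hW, hyW, ?_⟩
    rw [← hs', hg, map_zero, map_zero]
  · let c : ∀ a, extSections k (barInterval j (b a) (d a)) U := fun a =>
      ((biproduct.π (fun a => kSheaf k (barInterval j (b a) (d a))) a).hom.app (op U)).hom t
    obtain ⟨σ, hσ⟩ := hbar.surjective (j y) (fun a => (c a).1 ⟨y, hy⟩)
      fun a ha => (c a).2.1 ⟨y, hy⟩ ha
    let V₀ : Opens (TopCat.of ℝ) := U ⊓ hj.star (j y)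
    have hy₀ : y ∈ V₀ := ⟨hy, hj.self_mem_star y⟩
    let e : ∀ a, extSections k (barInterval j (b a) (d a)) V₀ := fun a =>
      ((barHom h hbar a).hom.app (op V₀)).hom (res F inf_le_right σ) -
        res (kSheaf k (barInterval j (b a) (d a))) inf_le_left (c a)
    have he : ∀ a, (e a).1 ⟨y, hy₀⟩ = 0 := by
      intro a
      change φ a (j y) (germ (h.isStar y) V₀ hy₀ (res F inf_le_right σ)) - (c a).1 ⟨y, hy⟩ = 0
      rw [germ_res, germ_self, hσ, sub_self]
    -- Supports of sections are closed, so each difference vanishes near `y`; there are finitely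
    -- many bars.
    have hev : ∀ᶠ z in 𝓝 (⟨y, hy₀⟩ : V₀), ∀ a, (e a).1 z = 0 := by
      rw [Filter.eventually_all]
      exact fun a => ((isExtSection_iff _ _).1 (e a).2).2.2 _ (he a)
    rw [eventually_nhds_iff] at hev
    obtain ⟨O, hO, hOo, hyO⟩ := hev
    let V : Opens (TopCat.of ℝ) := ⟨Subtype.val '' O, V₀.isOpen.isOpenMap_subtype_val O hOo⟩
    have hV : V ≤ V₀ := by
      rintro _ ⟨z, -, rfl⟩
      exact z.2
    refine ⟨V, hV.trans inf_le_left, ⟨_, hyO, rfl⟩, res F (hV.trans inf_le_right) σ, ?_⟩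
    refine biproduct_hom_ext_apply _ _ _ _ fun a => ?_
    rw [hlift, hom_res (biproduct.π _ a)]
    have h1 : res (kSheaf k (barInterval j (b a) (d a))) hV (e a) = 0 := by
      refine Subtype.ext (funext fun z => ?_)
      obtain ⟨z', hz', hzz⟩ := z.2
      have := hO z' hz' a
      obtain rfl : z' = ⟨z.1, hV z.2⟩ := Subtype.ext hzz
      exact this
    have h2 : res (kSheaf k (barInterval j (b a) (d a))) hV
        (((barHom h hbar a).hom.app (op V₀)).hom (res F inf_le_right σ)) =
        res (kSheaf k (barInterval j (b a) (d a))) hV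
          (res (kSheaf k (barInterval j (b a) (d a))) inf_le_left (c a)) := by
      rw [← sub_eq_zero, ← map_sub]
      exact h1
    rw [res_res, ← hom_res, res_res] at h2
    exact h2

end Bar

theorem IsAdapted.exists_iso (h : IsAdapted F hj) {N : ℕ} (hN : ∀ y, j y ≤ N) :
    ∃ (A : Type) (_ : Finite A) (I : A → Set ℝ), (∀ a, IsInterval (I a)) ∧
      Nonempty (F ≅ ⨁ fun a => kSheaf k (I a)) := by
  have hsub : ∀ i, i ∉ Set.range j → Subsingleton (F.obj.obj (op (hj.star i))) := fun i hi =>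
    subsingleton_sections F fun x hx => hi hx.1
  have hfin : ∀ i, Module.Finite k (F.obj.obj (op (hj.star i))) := by
    intro i
    by_cases hi : i ∈ Set.range j
    · obtain ⟨x, rfl⟩ := hi
      exact h.finite x
    · have := hsub i hi
      infer_instance
  obtain ⟨A, hA, b, d, φ, hbar⟩ := exists_isBarcode Odd (stepRight F hj) (stepLeft F hj) N
    (fun i hi => hsub i (by rintro ⟨x, rfl⟩; exact absurd (hN x) (by omega)))
  refine ⟨A, hA, fun a => barInterval j (b a) (d a), fun a => ⟨?_, ⟨?_⟩⟩, ?_⟩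
  -- If no stratum had index `b a`, the space there would be zero, against the surjectivity of the
  -- functionals of the bars through `b a`.
  · by_contra hempty
    have hb : b a ∉ Set.range j := by
      rintro ⟨y, hy⟩
      exact hempty ⟨y, hy.ge, hy.trans_le (hbar.le a)⟩
    have := hsub _ hb
    classical
    obtain ⟨u, hu⟩ := hbar.surjective (b a) (fun a' => if a' = a then 1 else 0) (by
      intro a' ha'
      rw [if_neg]
      rintro rfl
      exact ha' ⟨le_rfl, hbar.le _⟩)
    have h1 := hu a
    rw [Subsingleton.elim u 0, map_zero, if_pos rfl] at h1
    exact zero_ne_one h1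
  · rintro x ⟨hx, -⟩ y ⟨-, hy⟩ z hz
    exact ⟨hx.trans (hj.mono hz.1), (hj.mono hz.2).trans hy⟩
  · have := isIso_lift_barHom h hbar
    exact ⟨asIso (biproduct.lift (barHom h hbar))⟩

end Adapted

/-! ### The stratification defined by a finite set of points -/

section FiniteSet

variable (T : Finset ℝ)

/-- The number of the stratum containing `y` in the stratification of `ℝ` defined by a finite set
of points. -/
def stratumIndex (y : ℝ) : ℕ := (T.filter (· < y)).card + (T.filter (· ≤ y)).card

theorem stratumIndex_mono : Monotone (stratumIndex T) := by
  intro y z h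
  refine add_le_add (Finset.card_le_card ?_) (Finset.card_le_card ?_)
  · exact Finset.monotone_filter_right _ fun t _ ht => ht.trans_le h
  · exact Finset.monotone_filter_right _ fun t _ ht => le_trans ht h

theorem stratumIndex_le (y : ℝ) : stratumIndex T y ≤ T.card + T.card :=
  add_le_add (Finset.card_filter_le _ _) (Finset.card_filter_le _ _)

theorem stratumIndex_of_notMem {y : ℝ} (hy : y ∉ T) :
    stratumIndex T y = 2 * (T.filter (· < y)).card := by
  have : T.filter (· ≤ y) = T.filter (· < y) := Finset.filter_congr fun t ht =>
    ⟨fun h => lt_of_le_of_ne h fun h' => hy (h' ▸ ht), le_of_lt⟩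
  rw [stratumIndex, this, two_mul]

theorem stratumIndex_of_mem {y : ℝ} (hy : y ∈ T) :
    stratumIndex T y = 2 * (T.filter (· < y)).card + 1 := by
  have : T.filter (· ≤ y) = insert y (T.filter (· < y)) := by
    ext t
    simp only [Finset.mem_filter, Finset.mem_insert, le_iff_lt_or_eq]
    constructor
    · rintro ⟨h, h' | rfl⟩
      exacts [.inr ⟨h, h'⟩, .inl rfl]
    · rintro (rfl | ⟨h, h'⟩)
      exacts [⟨hy, .inr rfl⟩, ⟨h, .inl h'⟩]
  rw [stratumIndex, this, Finset.card_insert_of_notMem (by simp)]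
  ring

theorem odd_stratumIndex_iff {y : ℝ} : Odd (stratumIndex T y) ↔ y ∈ T := by
  by_cases hy : y ∈ T
  · simp [stratumIndex_of_mem T hy, hy]
  · simp [stratumIndex_of_notMem T hy, hy]

theorem eventually_lt_iff (y : ℝ) :
    ∀ᶠ z in 𝓝 y, ∀ t ∈ T, t ≠ y → (t < z ↔ t < y) ∧ (t ≤ z ↔ t ≤ y) := by
  rw [Filter.eventually_all_finset]
  intro t _
  rcases lt_trichotomy t y with h | rfl | h
  · filter_upwards [lt_mem_nhds h] with z hz _
    exact ⟨iff_of_true hz h, iff_of_true hz.le h.le⟩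
  · exact Filter.Eventually.of_forall fun z hz => (hz rfl).elim
  · filter_upwards [gt_mem_nhds h] with z hz _
    exact ⟨iff_of_false hz.not_gt h.not_gt, iff_of_false hz.not_ge h.not_ge⟩

theorem isStratumIndex_stratumIndex : IsStratumIndex (stratumIndex T) where
  mono := stratumIndex_mono T
  even y hy := by
    have hyT : y ∉ T := by rwa [← odd_stratumIndex_iff, Nat.not_odd_iff_even]
    filter_upwards [eventually_lt_iff T y] with z hz
    have hne : ∀ t ∈ T, t ≠ y := fun t ht h => hyT (h ▸ ht)
    rw [stratumIndex, stratumIndex, Finset.filter_congr fun t ht => (hz t ht (hne t ht)).1,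
      Finset.filter_congr fun t ht => (hz t ht (hne t ht)).2]
  odd y hy := by
    have hyT : y ∈ T := by rwa [← odd_stratumIndex_iff]
    filter_upwards [eventually_lt_iff T y] with z hz
    rw [stratumIndex_of_mem T hyT]
    constructor
    · intro hzy
      have h1 : T.filter (· < z) = T.filter (· < y) := Finset.filter_congr fun t ht => by
        by_cases hty : t = y
        · subst hty
          exact iff_of_false hzy.not_gt (lt_irrefl _)
        · exact (hz t ht hty).1
      have h2 : T.filter (· ≤ z) = T.filter (· < y) := Finset.filter_congr fun t ht => by
        by_cases hty : t = y
        · subst hty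
          exact iff_of_false hzy.not_ge (lt_irrefl _)
        · rw [(hz t ht hty).2, le_iff_lt_or_eq, or_iff_left hty]
      rw [stratumIndex, h1, h2]
      ring
    · intro hzy
      have h1 : T.filter (· < z) = T.filter (· ≤ y) := Finset.filter_congr fun t ht => by
        by_cases hty : t = y
        · subst hty
          exact iff_of_true hzy le_rfl
        · rw [(hz t ht hty).1, le_iff_lt_or_eq, or_iff_left hty]
      have h2 : T.filter (· ≤ z) = T.filter (· ≤ y) := Finset.filter_congr fun t ht => by
        by_cases hty : t = y
        · subst hty
          exact iff_of_true hzy.le le_rfl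
        · exact (hz t ht hty).2
      have h3 := stratumIndex_of_mem T hyT
      rw [stratumIndex] at h3
      rw [stratumIndex, h1, h2]
      omega

theorem stratumIndex_lt_of_mem {y z : ℝ} (hyz : y < z) (h : y ∈ T ∨ z ∈ T) :
    stratumIndex T y < stratumIndex T z := by
  have h1 : T.filter (· ≤ y) ⊆ T.filter (· < z) :=
    Finset.monotone_filter_right _ fun t _ ht => lt_of_le_of_lt ht hyz
  have h2 : T.filter (· < y) ⊆ T.filter (· ≤ z) :=
    Finset.monotone_filter_right _ fun t _ ht => (ht.trans hyz).le
  rw [stratumIndex, stratumIndex, add_comm]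
  rcases h with h | h
  · refine add_lt_add_of_le_of_lt (Finset.card_le_card h1) (Finset.card_lt_card ⟨h2, fun h' => ?_⟩)
    exact lt_irrefl y (Finset.mem_filter.1 (h' (Finset.mem_filter.2 ⟨h, hyz.le⟩))).2
  · refine add_lt_add_of_le_of_lt (Finset.card_le_card h1) (Finset.card_lt_card ⟨h2, fun h' => ?_⟩)
    exact hyz.not_gt (Finset.mem_filter.1 (h' (Finset.mem_filter.2 ⟨h, le_rfl⟩))).2

end FiniteSet

/-! ### Sheaves that are constant on the complement of a finite set -/

section ConstOn

variable {k : Type u} [Field k] (F : Sh k ℝ)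

/-- `F` restricts to a constant sheaf of finite rank on each interval contained in `O`. -/
def IsConstOn (O : Set ℝ) : Prop :=
  ∀ U : Opens (TopCat.of ℝ), (U : Set ℝ) ⊆ O → (U : Set ℝ).OrdConnected → (U : Set ℝ).Nonempty →
    Module.Finite k (F.obj.obj (op U)) ∧
    ∀ (W : Opens (TopCat.of ℝ)) (h : W ≤ U), (W : Set ℝ).OrdConnected → (W : Set ℝ).Nonempty →
      Function.Bijective (res F h)

/-- By gluing, `F(U)` is the fibre product of `F(A)` and `F(W)` over `F(A ⊓ W)`, and a bijection
stays bijective under base change. -/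
theorem bijective_res_of_le_sup {U A W : Opens (TopCat.of ℝ)} (hA : A ≤ U) (hW : W ≤ U)
    (hU : U ≤ A ⊔ W) (h : Function.Bijective (res F (inf_le_left : A ⊓ W ≤ A))) :
    Function.Bijective (res F hW) := by
  constructor
  · intro s t hst
    refine eq_of_res_eq_of_le_sup F hA hW hU (h.1 ?_) hst
    have := congrArg (res F (inf_le_right : A ⊓ W ≤ W)) hst
    rw [res_res, res_res] at this ⊢
    exact this
  · intro t
    obtain ⟨s, hs⟩ := h.2 (res F inf_le_right t)
    obtain ⟨r, -, hr⟩ := exists_res_eq_of_le_sup F hA hW hU s t hs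
    exact ⟨r, hr⟩

variable {F}

/-- The point to prove is that a neighbourhood `W` of `x ∈ T` has the same sections as the star `U`
of `x`. The open set `W` is enlarged first by the left half `A` of the star and then by the right
half `B`; constancy on each half makes both restrictions bijective. -/
theorem isAdapted_of_isConstOn {T : Finset ℝ}
    (hconst : ∀ y ∉ T, IsConstOn F ((isStratumIndex_stratumIndex T).star (stratumIndex T y)))
    (hfin : ∀ t ∈ T, ∀ U : Opens (TopCat.of ℝ), IsStar F U t → Module.Finite k (F.obj.obj (op U))) :
    IsAdapted F (isStratumIndex_stratumIndex T) := by
  have hj := isStratumIndex_stratumIndex T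
  have hbij : ∀ (m : ℕ) (W : Opens (TopCat.of ℝ)) (h : W ≤ hj.star m), (W : Set ℝ).OrdConnected →
      (∃ x ∈ W, stratumIndex T x = m) → Function.Bijective (res F h) := by
    rintro _ W h hc ⟨x, hx, rfl⟩
    by_cases hxT : x ∈ T
    · let U := hj.star (stratumIndex T x)
      have hside : ∀ O : Opens (TopCat.of ℝ), O ≤ U → x ∉ O → (O : Set ℝ).OrdConnected →
          (∃ n, ∀ z ∈ O, stratumIndex T z = n) → ∀ (W' : Opens (TopCat.of ℝ)) (h' : W' ≤ O),
          (W' : Set ℝ).OrdConnected → (W' : Set ℝ).Nonempty → Function.Bijective (res F h') := by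
        rintro O hO hxO hcO ⟨n, hn⟩ W' h' hc' ⟨y, hy⟩
        have hyO : y ∈ O := h' hy
        -- Distinct points of `T` have distinct odd indices, whereas indices in the star of `x`
        -- differ from that of `x` by at most one.
        have hyT : y ∉ T := by
          intro hyT
          have hyx : y ≠ x := by rintro rfl; exact hxO hyO
          have h1 := (odd_stratumIndex_iff T).2 hyT
          have h2 := (odd_stratumIndex_iff T).2 hxT
          have h3 : stratumIndex T y ≠ stratumIndex T x := by
            rcases lt_or_gt_of_ne hyx with h | h
            · exact (stratumIndex_lt_of_mem T h (.inl hyT)).ne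
            · exact (stratumIndex_lt_of_mem T h (.inr hyT)).ne'
          have h4 := (hj.mem_star.1 (hO hyO)).2
          rw [Nat.odd_iff] at h1 h2
          omega
        refine (hconst y hyT O ?_ hcO ⟨y, hyO⟩).2 W' h' hc' ⟨y, hy⟩
        intro z hz
        exact ⟨⟨y, rfl⟩, .inl ((hn z hz).trans (hn y hyO).symm)⟩
      let A : Opens (TopCat.of ℝ) := U ⊓ ⟨Set.Iio x, isOpen_Iio⟩
      let B : Opens (TopCat.of ℝ) := U ⊓ ⟨Set.Ioi x, isOpen_Ioi⟩
      have hA := hside A inf_le_left (fun hx => lt_irrefl x hx.2)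
        ((hj.ordConnected_star _).inter Set.ordConnected_Iio)
        ⟨stratumIndex T x - 1, fun z hz => by
          have h1 := stratumIndex_lt_of_mem T hz.2 (.inr hxT)
          have h2 := (hj.mem_star.1 hz.1).2
          omega⟩
      have hB := hside B inf_le_left (fun hx => lt_irrefl x hx.2)
        ((hj.ordConnected_star _).inter Set.ordConnected_Ioi)
        ⟨stratumIndex T x + 1, fun z hz => by
          have h1 := stratumIndex_lt_of_mem T hz.2 (.inl hxT)
          have h2 := (hj.mem_star.1 hz.1).2
          omega⟩
      obtain ⟨ε, hε, hball⟩ := Metric.isOpen_iff.1 W.isOpen x hx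
      rw [Real.ball_eq_Ioo] at hball
      have hcA : ((A ⊓ W : Opens (TopCat.of ℝ)) : Set ℝ).OrdConnected :=
        ((hj.ordConnected_star _).inter Set.ordConnected_Iio).inter hc
      have hcB : ((B ⊓ W : Opens (TopCat.of ℝ)) : Set ℝ).OrdConnected :=
        ((hj.ordConnected_star _).inter Set.ordConnected_Ioi).inter hc
      have hneA : ((A ⊓ W : Opens (TopCat.of ℝ)) : Set ℝ).Nonempty := by
        have hmem : x - ε / 2 ∈ W := hball ⟨by linarith, by linarith⟩
        exact ⟨x - ε / 2, ⟨h hmem, show x - ε / 2 < x by linarith⟩, hmem⟩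
      have hneB : ((B ⊓ W : Opens (TopCat.of ℝ)) : Set ℝ).Nonempty := by
        have hmem : x + ε / 2 ∈ W := hball ⟨by linarith, by linarith⟩
        exact ⟨x + ε / 2, ⟨h hmem, show x < x + ε / 2 by linarith⟩, hmem⟩
      have hBW : B ⊓ (A ⊔ W) = B ⊓ W := by
        refine le_antisymm ?_ (inf_le_inf le_rfl le_sup_right)
        rintro z ⟨hzB, hzA | hzW⟩
        · exact (lt_asymm (show z < x from hzA.2) hzB.2).elim
        · exact ⟨hzB, hzW⟩
      have h1 : Function.Bijective (res F (le_sup_right : W ≤ A ⊔ W)) :=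
        bijective_res_of_le_sup F le_sup_left le_sup_right le_rfl
          (hA (A ⊓ W) inf_le_left hcA hneA)
      have hAW : A ⊔ W ≤ U := sup_le inf_le_left h
      have h2 : Function.Bijective (res F hAW) := by
        refine bijective_res_of_le_sup F (A := B) inf_le_left hAW ?_
          (hB (B ⊓ (A ⊔ W)) inf_le_left (hBW ▸ hcB) (hBW ▸ hneB))
        intro z hz
        rcases lt_trichotomy z x with hzx | rfl | hzx
        exacts [.inr (.inl ⟨hz, hzx⟩), .inr (.inr hx), .inl ⟨hz, hzx⟩]
      have h3 : ⇑(res F h) = res F (le_sup_right : W ≤ A ⊔ W) ∘ res F hAW := by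
        funext s
        exact (res_res F hAW le_sup_right s).symm
      rw [h3]
      exact h1.comp h2
    · exact (hconst x hxT _ subset_rfl (hj.ordConnected_star _) ⟨x, h hx⟩).2 W h hc ⟨x, hx⟩
  refine ⟨hbij, fun x => ?_⟩
  by_cases hxT : x ∈ T
  · refine hfin x hxT _ ⟨hj.self_mem_star x, fun W hW => ?_⟩
    obtain ⟨W', hW', hx, hc⟩ := exists_ordConnected_nhds
      (show x ∈ W ⊓ hj.star (stratumIndex T x) from ⟨hW, hj.self_mem_star x⟩)
    exact ⟨W', hW'.trans inf_le_left, hW'.trans inf_le_right, hx,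
      hbij _ _ _ hc ⟨x, hx, rfl⟩⟩
  · exact (hconst x hxT _ subset_rfl (hj.ordConnected_star _) ⟨x, hj.self_mem_star x⟩).1

end ConstOn

/-! ### Constructible sheaves with compact support -/

/-- A linear subspace of `ℝ` is `0` or `ℝ`. In the first case the point is isolated in `S`, and a
connected set with an isolated point is a singleton; if the second case always holds, `S` is open.
-/
theorem isOpen_or_eq_singleton_of_isAnalyticSubmanifold {S : Set ℝ} (hS : IsAnalyticSubmanifold S)
    (hc : _root_.IsConnected S) : IsOpen S ∨ ∃ x, S = {x} := by
  by_cases h : ∃ x ∈ S, ∃ O : Set ℝ, IsOpen O ∧ S ∩ O = {x}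
  · right
    obtain ⟨x, hx, O, hO, hSO⟩ := h
    refine ⟨x, Set.Subset.antisymm (fun y hy => ?_) (by simpa using hx)⟩
    by_contra hyx
    have hxO : x ∈ S ∩ O := hSO.symm ▸ rfl
    obtain ⟨z, hzS, hzO, hzx⟩ := hc.2 O {x}ᶜ hO isOpen_compl_singleton
      (fun z hz => by
        by_cases hzx : z = x
        exacts [.inl (hzx ▸ hxO.2), .inr hzx])
      ⟨x, hxO⟩ ⟨y, hy, hyx⟩
    exact hzx (hSO ▸ ⟨hzS, hzO⟩ : z ∈ ({x} : Set ℝ))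
  · left
    rw [isOpen_iff_mem_nhds]
    intro x hx
    obtain ⟨φ, -, hxφ, W, hW⟩ := hS x hx
    rcases eq_bot_or_eq_top W with rfl | rfl
    · refine (h ⟨x, hx, φ.source, φ.open_source, ?_⟩).elim
      rw [hW]
      have hx0 : φ x = 0 := (hW ▸ ⟨hx, hxφ⟩ : x ∈ φ.source ∩ φ ⁻¹' ((⊥ : Submodule ℝ ℝ) : Set ℝ)).2
      ext y
      constructor
      · rintro ⟨hy, hy0⟩
        exact φ.injOn hy hxφ ((show φ y = 0 from hy0).trans hx0.symm)
      · rintro rfl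
        exact ⟨hxφ, hx0⟩
    · refine Filter.mem_of_superset (φ.open_source.mem_nhds hxφ) fun y hy => ?_
      exact (hW ▸ ⟨hy, trivial⟩ : y ∈ S ∩ φ.source).1

section Constructible

variable {k : Type u} [Field k] {F : Sh k ℝ}

theorem subsingleton_of_disjoint_supp {U : Opens (TopCat.of ℝ)}
    (hU : Disjoint (U : Set ℝ) (supp F)) : Subsingleton (F.obj.obj (op U)) := by
  refine ⟨fun s t => eq_of_locally_res_eq F s t fun x hx => ?_⟩
  have hx' : x ∉ supp F := Set.disjoint_left.1 hU hx
  rw [supp, Set.notMem_compl_iff] at hx'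
  simp only [Set.mem_iUnion] at hx'
  obtain ⟨O, hO, hxO⟩ := hx'
  have : Subsingleton (F.obj.obj (op (U ⊓ O))) :=
    ModuleCat.subsingleton_of_isZero (hO (U ⊓ O) inf_le_right)
  exact ⟨U ⊓ O, inf_le_left, ⟨hx, hxO⟩, Subsingleton.elim _ _⟩

theorem isConstOn_of_restrict {S : Set ℝ} (hS : IsOpen S)
    (hF : IsConstantOfFiniteRank (restrict F S)) : IsConstOn F S := by
  rintro U hUS hU ⟨x, hx⟩
  refine ⟨finite_of_restrict hS hF hUS hU.isPreconnected hx, ?_⟩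
  rintro W h hW ⟨y, hy⟩
  exact bijective_res_of_restrict hS hF h hUS hU.isPreconnected hW.isPreconnected hy

/-- This serves the points of `T` that lie inside an open stratum. -/
theorem IsStar.finite_of_isConstOn {U : Opens (TopCat.of ℝ)} {t : ℝ} (hU : IsStar F U t)
    {S : Set ℝ} (hS : IsOpen S) (ht : t ∈ S) (hF : IsConstOn F S) :
    Module.Finite k (F.obj.obj (op U)) := by
  obtain ⟨W, hW, htW, hc⟩ := exists_ordConnected_nhds
    (show t ∈ (⟨S, hS⟩ : Opens (TopCat.of ℝ)) ⊓ U from ⟨ht, hU.mem⟩)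
  obtain ⟨W', hW', h', -, hinj, -⟩ := hU.exists_le W htW
  have hfin := (hF W (hW.trans inf_le_left) hc ⟨t, htW⟩).1
  refine FiniteDimensional.of_injective (res F (hW.trans inf_le_right)) fun s s' hs => hinj ?_
  have := congrArg (res F hW') hs
  rwa [res_res, res_res] at this

theorem IsConstructible.exists_isAdapted (hF : IsConstructible F) (hsupp : IsCompact (supp F)) :
    ∃ T : Finset ℝ, IsAdapted F (isStratumIndex_stratumIndex T) := by
  obtain ⟨𝒮, h𝒮, hconst⟩ := hF
  obtain ⟨R, hR⟩ : ∃ R, supp F ⊆ Set.Icc (-R) R := by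
    obtain ⟨R, hR⟩ := hsupp.isBounded.subset_closedBall 0
    refine ⟨R, hR.trans ?_⟩
    rw [Real.closedBall_eq_Icc]
    simp
  have hfinite : {t | t ∈ Set.Icc (-R) R ∧ {t} ∈ 𝒮}.Finite := by
    have h1 := h𝒮.locallyFinite.finite_nonempty_inter_compact (isCompact_Icc (a := -R) (b := R))
    refine Set.Finite.of_finite_image (f := fun t : ℝ => ({t} : Set ℝ))
      ((h1.image Subtype.val).subset ?_) (Set.injOn_of_injective Set.singleton_injective)
    rintro _ ⟨t, ⟨ht, htS⟩, rfl⟩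
    exact ⟨⟨{t}, htS⟩, ⟨t, rfl, ht⟩, rfl⟩
  have hstrat : ∀ t, ∃ S ∈ 𝒮, t ∈ S ∧ (IsOpen S ∨ S = {t}) := by
    intro t
    obtain ⟨S, ⟨hS, htS⟩, -⟩ := h𝒮.partition.2 t
    refine ⟨S, hS, htS, ?_⟩
    rcases isOpen_or_eq_singleton_of_isAnalyticSubmanifold (h𝒮.submanifold S hS)
      (h𝒮.connected S hS) with h | ⟨x, rfl⟩
    exacts [.inl h, .inr (by rw [Set.mem_singleton_iff.1 htS])]
  -- The points `-R` and `R` separate the region where `F` may be nonzero from the region where it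
  -- vanishes. Outside `[-R, R]` there may be infinitely many point strata, which play no role.
  let T : Finset ℝ := hfinite.toFinset ∪ {-R, R}
  have hj := isStratumIndex_stratumIndex T
  refine ⟨T, isAdapted_of_isConstOn (fun y hy => ?_) fun t ht U hU => ?_⟩
  · have hO : ∀ z ∈ hj.star (stratumIndex T y), z ∉ T := by
      rintro z ⟨-, hz⟩
      rw [← odd_stratumIndex_iff] at hy ⊢
      simp only [hy, false_and, or_false] at hz
      rwa [hz]
    have hOc := hj.ordConnected_star (stratumIndex T y)
    have hyO := hj.self_mem_star y
    by_cases hyR : y ∈ Set.Icc (-R) R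
    · have hOR : ∀ z ∈ hj.star (stratumIndex T y), z ∈ Set.Icc (-R) R := by
        intro z hz
        by_contra hzR
        rcases not_and_or.1 hzR with h | h
        · exact hO (-R) (hOc.out hz hyO ⟨(not_le.1 h).le, hyR.1⟩) (by simp [T])
        · exact hO R (hOc.out hyO hz ⟨hyR.2, (not_le.1 h).le⟩) (by simp [T])
      have hopen : ∀ z ∈ hj.star (stratumIndex T y), ∃ S ∈ 𝒮, z ∈ S ∧ IsOpen S := by
        intro z hz
        obtain ⟨S, hS, hzS, h | rfl⟩ := hstrat z
        · exact ⟨S, hS, hzS, h⟩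
        · refine (hO z hz ?_).elim
          simp only [T, Finset.mem_union, Set.Finite.mem_toFinset]
          exact .inl ⟨hOR z hz, hS⟩
      obtain ⟨S, hS, hyS, hSo⟩ := hopen y hyO
      have hsub : (hj.star (stratumIndex T y) : Set ℝ) ⊆ S := by
        refine hOc.isPreconnected.subset_left_of_subset_union hSo
          (v := ⋃₀ {S' | S' ∈ 𝒮 ∧ IsOpen S' ∧ S' ≠ S}) (isOpen_sUnion fun S' h => h.2.1) ?_ ?_
          ⟨y, hyO, hyS⟩
        · rw [Set.disjoint_sUnion_right]
          exact fun S' h => h𝒮.partition.pairwiseDisjoint hS h.1 (Ne.symm h.2.2)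
        · intro z hz
          obtain ⟨S', hS', hzS', hSo'⟩ := hopen z hz
          by_cases h : S' = S
          · exact .inl (h ▸ hzS')
          · exact .inr ⟨S', ⟨hS', hSo', h⟩, hzS'⟩
      exact fun U hU => isConstOn_of_restrict hSo (hconst S hS) U (hU.trans hsub)
    · have hdisj : ∀ z ∈ hj.star (stratumIndex T y), z ∉ supp F := by
        intro z hz hzs
        have hzR := hR hzs
        rcases not_and_or.1 hyR with h | h
        · exact hO (-R) (hOc.out hyO hz ⟨(not_le.1 h).le, hzR.1⟩) (by simp [T])
        · exact hO R (hOc.out hz hyO ⟨hzR.2, (not_le.1 h).le⟩) (by simp [T])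
      have hsub : ∀ U : Opens (TopCat.of ℝ), U ≤ hj.star (stratumIndex T y) →
          Subsingleton (F.obj.obj (op U)) := fun U hU =>
        subsingleton_of_disjoint_supp (Set.disjoint_left.2 fun z hz => hdisj z (hU hz))
      intro U hU _ _
      have h1 := hsub U hU
      refine ⟨inferInstance, fun W h _ _ => ?_⟩
      have h2 := hsub W (h.trans hU)
      exact ⟨fun _ _ _ => Subsingleton.elim _ _, fun s => ⟨0, Subsingleton.elim _ _⟩⟩
  · obtain ⟨S, hS, htS, hSo | rfl⟩ := hstrat t
    · exact hU.finite_of_isConstOn hSo htS (isConstOn_of_restrict hSo (hconst S hS))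
    · exact finite_of_restrict_singleton hU (hconst _ hS)

end Constructible

/-! ### Morphisms between the sheaves `k_I` -/

section Coefficient

variable {k : Type u} [Field k] {I J : Set ℝ}

/-- An interval is locally closed; hence its indicator function is a section of `k_I` near each of
its points. -/
theorem exists_nhds_isClosed_inter (hI : I.OrdConnected) {x : ℝ} (hx : x ∈ I) :
    ∃ W : Opens (TopCat.of ℝ), x ∈ W ∧ ∀ z ∈ W, z ∉ I → ∀ᶠ y in 𝓝 z, y ∉ I := by
  have hleft : ∃ O : Set ℝ, IsOpen O ∧ x ∈ O ∧ ∀ z ∈ O, z < x → z ∉ I → ∀ᶠ y in 𝓝 z, y ∉ I := by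
    by_cases h : ∃ a ∈ I, a < x
    · obtain ⟨a, ha, hax⟩ := h
      exact ⟨Set.Ioi a, isOpen_Ioi, hax, fun z hz hzx hzI =>
        (hzI (hI.out ha hx ⟨le_of_lt hz, hzx.le⟩)).elim⟩
    · push Not at h
      refine ⟨Set.univ, isOpen_univ, trivial, fun z _ hzx _ => ?_⟩
      filter_upwards [gt_mem_nhds hzx] with y hy hyI
      exact (h y hyI).not_gt hy
  have hright : ∃ O : Set ℝ, IsOpen O ∧ x ∈ O ∧ ∀ z ∈ O, x < z → z ∉ I → ∀ᶠ y in 𝓝 z, y ∉ I := by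
    by_cases h : ∃ a ∈ I, x < a
    · obtain ⟨a, ha, hax⟩ := h
      exact ⟨Set.Iio a, isOpen_Iio, hax, fun z hz hzx hzI =>
        (hzI (hI.out hx ha ⟨hzx.le, le_of_lt hz⟩)).elim⟩
    · push Not at h
      refine ⟨Set.univ, isOpen_univ, trivial, fun z _ hzx _ => ?_⟩
      filter_upwards [lt_mem_nhds hzx] with y hy hyI
      exact (h y hyI).not_gt hy
  obtain ⟨O, hO, hxO, h⟩ := hleft
  obtain ⟨O', hO', hxO', h'⟩ := hright
  refine ⟨⟨O ∩ O', hO.inter hO'⟩, ⟨hxO, hxO'⟩, fun z hz hzI => ?_⟩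
  rcases lt_trichotomy z x with hzx | rfl | hzx
  exacts [h z hz.1 hzx hzI, (hzI hx).elim, h' z hz.2 hzx hzI]

variable (k) in
theorem exists_section_eq_one (hI : I.OrdConnected) {x : ℝ} (hx : x ∈ I) :
    ∃ (W : Opens (TopCat.of ℝ)) (_ : x ∈ W) (e : extSections k I W),
      ∀ y : W, y.1 ∈ I → e.1 y = 1 := by
  classical
  obtain ⟨W, hxW, hW⟩ := exists_nhds_isClosed_inter hI hx
  refine ⟨W, hxW, ⟨fun y => if y.1 ∈ I then 1 else 0, ?_⟩, fun y hy => if_pos hy⟩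
  change IsExtSection I _
  rw [isExtSection_iff]
  refine ⟨fun y hy => if_neg hy, fun y hy => Filter.Eventually.of_forall fun z hz => ?_,
    fun y hy => ?_⟩
  · rw [if_pos hz, if_pos hy]
  · have hyI : y.1 ∉ I := fun h => by simp [h] at hy
    filter_upwards [continuous_subtype_val.continuousAt.eventually (hW y.1 y.2 hyI)] with z hz
    exact if_neg hz

/-- The action of a morphism `k_I ⟶ k_J` on sections, which are functions. -/
def homApply (α : kSheaf k I ⟶ kSheaf k J) {U : Opens (TopCat.of ℝ)} (s : extSections k I U) :
    extSections k J U :=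
  (α.hom.app (op U)).hom s

theorem homApply_comp {K : Set ℝ} (α : kSheaf k I ⟶ kSheaf k J) (β : kSheaf k J ⟶ kSheaf k K)
    {U : Opens (TopCat.of ℝ)} (s : extSections k I U) :
    homApply (α ≫ β) s = homApply β (homApply α s) := rfl

theorem homApply_eq_zero (α : kSheaf k I ⟶ kSheaf k J) {U : Opens (TopCat.of ℝ)}
    (s : extSections k I U) (x : U) (hs : s.1 x = 0) : (homApply α s).1 x = 0 := by
  have hev := ((isExtSection_iff _ _).1 s.2).2.2 x hs
  rw [eventually_nhds_iff] at hev
  obtain ⟨O, hO, hOo, hxO⟩ := hev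
  let V : Opens (TopCat.of ℝ) := ⟨Subtype.val '' O, U.isOpen.isOpenMap_subtype_val O hOo⟩
  have hV : V ≤ U := by
    rintro _ ⟨z, -, rfl⟩
    exact z.2
  have h0 : res (kSheaf k I) hV s = 0 := by
    refine Subtype.ext (funext fun z => ?_)
    obtain ⟨z', hz', hzz⟩ := z.2
    have := hO z' hz'
    obtain rfl : z' = ⟨z.1, hV z.2⟩ := Subtype.ext hzz
    exact this
  have h1 := hom_res α hV s
  rw [h0, map_zero] at h1
  exact (congrArg (fun g : extSections k J V => g.1 ⟨x.1, ⟨x, hxO, rfl⟩⟩) h1).symm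

/-- A morphism `k_I ⟶ k_J` is multiplication by a function, which is constant if `I = J`. -/
theorem exists_coeff (hI : I.OrdConnected) (α : kSheaf k I ⟶ kSheaf k J) :
    ∃ c : ℝ → k, (∀ (U : Opens (TopCat.of ℝ)) (s : extSections k I U) (x : U),
      (homApply α s).1 x = c x * s.1 x) ∧ (∀ x ∉ J, c x = 0) ∧
      (I = J → ∀ x ∈ I, ∀ y ∈ I, c x = c y) := by
  classical
  choose W hW e he using fun x : I => exists_section_eq_one k hI x.2
  -- The coefficient at `x` is the value at `x` of the image of a local section equal to 1 on `I`.
  -- Since `s - s(x) e` vanishes at `x`, so does its image, which gives the formula for every `s`.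
  let c : ℝ → k := fun x => if hx : x ∈ I then (homApply α (e ⟨x, hx⟩)).1 ⟨x, hW ⟨x, hx⟩⟩ else 0
  have hc : ∀ (U : Opens (TopCat.of ℝ)) (s : extSections k I U) (x : U),
      (homApply α s).1 x = c x * s.1 x := by
    intro U s x
    by_cases hx : x.1 ∈ I
    · let V : Opens (TopCat.of ℝ) := U ⊓ W ⟨x.1, hx⟩
      have hxV : x.1 ∈ V := ⟨x.2, hW ⟨x.1, hx⟩⟩
      let sV : extSections k I V := res (kSheaf k I) (inf_le_left : V ≤ U) s
      let eV : extSections k I V :=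
        res (kSheaf k I) (inf_le_right : V ≤ W ⟨x.1, hx⟩) (e ⟨x.1, hx⟩)
      have h1 : (homApply α (sV - s.1 x • eV)).1 ⟨x.1, hxV⟩ = 0 := by
        apply homApply_eq_zero
        change s.1 x - s.1 x • (e ⟨x.1, hx⟩).1 ⟨x.1, hW ⟨x.1, hx⟩⟩ = 0
        rw [he ⟨x.1, hx⟩ _ hx]
        simp
      have h2 : homApply α (sV - s.1 x • eV) = homApply α sV - s.1 x • homApply α eV :=
        (map_sub (α.hom.app (op V)).hom sV (s.1 x • eV)).trans
          (congrArg (homApply α sV - ·) (map_smul (α.hom.app (op V)).hom (s.1 x) eV))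
      have h3 : (homApply α sV).1 ⟨x.1, hxV⟩ = (homApply α s).1 x :=
        congrArg (fun g : extSections k J V => g.1 ⟨x.1, hxV⟩) (hom_res α inf_le_left s)
      have h4 : (homApply α eV).1 ⟨x.1, hxV⟩ =
          (homApply α (e ⟨x.1, hx⟩)).1 ⟨x.1, hW ⟨x.1, hx⟩⟩ :=
        congrArg (fun g : extSections k J V => g.1 ⟨x.1, hxV⟩)
          (hom_res α inf_le_right (e ⟨x.1, hx⟩))
      rw [h2] at h1
      change (homApply α sV).1 ⟨x.1, hxV⟩ - s.1 x • (homApply α eV).1 ⟨x.1, hxV⟩ = 0 at h1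
      rw [h3, h4] at h1
      simp only [c, dif_pos hx]
      rw [sub_eq_zero.1 h1, smul_eq_mul, mul_comm]
    · have : s.1 x = 0 := s.2.1 x hx
      rw [homApply_eq_zero α s x this, this, mul_zero]
  refine ⟨c, hc, fun x hx => ?_, ?_⟩
  · by_cases hxI : x ∈ I
    · simp only [c, dif_pos hxI]
      exact (homApply α (e ⟨x, hxI⟩)).2.1 _ hx
    · exact dif_neg hxI
  · rintro rfl x hx y hy
    have : PreconnectedSpace I := Subtype.preconnectedSpace hI.isPreconnected
    have hlc : IsLocallyConstant fun z : I => c z := by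
      rw [IsLocallyConstant.iff_eventually_eq]
      intro z
      have h1 := ((isExtSection_iff _ _).1 (homApply α (e z)).2).2.1 ⟨z.1, hW z⟩ z.2
      have h2 : ∀ᶠ y in 𝓝 z.1, ∀ hy : y ∈ W z, y ∈ I → c y = c z.1 := by
        have h3 := (W z).isOpen.isOpenEmbedding_subtypeVal.map_nhds_eq ⟨z.1, hW z⟩
        rw [← h3, Filter.eventually_map]
        filter_upwards [h1] with y hy hyW hyI
        have h4 := hy hyI
        rwa [hc, hc, he z _ hyI, he z ⟨z.1, hW z⟩ z.2, mul_one, mul_one] at h4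
      have h5 : ∀ᶠ y in 𝓝 z.1, y ∈ W z := (W z).isOpen.mem_nhds (hW z)
      filter_upwards [continuous_subtype_val.continuousAt.eventually (h2.and h5)] with y hy
      exact hy.1 hy.2 y.2
    exact hlc.apply_eq_of_preconnectedSpace ⟨x, hx⟩ ⟨y, hy⟩

/-- The composition of morphisms `k_I ⟶ k_J ⟶ k_I` vanishes if `I ≠ J`. -/
theorem homApply_comp_eq_zero (hI : I.OrdConnected) (hJ : J.OrdConnected) (hIJ : I ≠ J)
    (α : kSheaf k I ⟶ kSheaf k J) (β : kSheaf k J ⟶ kSheaf k I) {U : Opens (TopCat.of ℝ)}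
    (s : extSections k I U) (x : U) : (homApply β (homApply α s)).1 x = 0 := by
  obtain ⟨c, hc, hc0, -⟩ := exists_coeff hI α
  obtain ⟨d, hd, hd0, -⟩ := exists_coeff hJ β
  -- An endomorphism of `k_K` has constant coefficient on `K`, so it is zero as soon as its
  -- coefficient vanishes at one point of `K`.
  have key : ∀ {K : Set ℝ} (hK : K.OrdConnected) (γ : kSheaf k K ⟶ kSheaf k K) (r : ℝ → k)
      (hr : ∀ (U : Opens (TopCat.of ℝ)) (s : extSections k K U) (x : U),
        (homApply γ s).1 x = r x * s.1 x) (z : ℝ) (hz : z ∈ K) (hrz : r z = 0) (x : ℝ) (hx : x ∈ K),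
      r x = 0 := by
    intro K hK γ r hr z hz hrz x hx
    obtain ⟨q, hq, -, hconst⟩ := exists_coeff hK γ
    have h : ∀ y ∈ K, r y = q y := by
      intro y hy
      obtain ⟨W, hW, e, he⟩ := exists_section_eq_one k hK hy
      have := hr W e ⟨y, hW⟩
      rw [hq, he _ hy, mul_one, mul_one] at this
      exact this.symm
    rw [h x hx, hconst rfl x hx z hz, ← h z hz, hrz]
  rw [hd, hc]
  by_cases hx : x.1 ∈ I
  · suffices d x * c x = 0 by rw [← mul_assoc, this, zero_mul]
    -- Both composites `α ≫ β` and `β ≫ α` have coefficient `d * c`. The one used is the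
    -- endomorphism of the sheaf whose interval has a point outside the other.
    by_cases hsub : I ⊆ J
    · obtain ⟨z, hzJ, hzI⟩ := Set.exists_of_ssubset (hsub.ssubset_of_ne hIJ)
      refine key hJ (β ≫ α) (fun x => d x * c x) (fun U s x => ?_) z hzJ ?_ x.1 (hsub hx)
      · rw [homApply_comp, hc, hd]
        ring
      · simp [hd0 z hzI]
    · obtain ⟨z, hzI, hzJ⟩ := Set.not_subset.1 hsub
      refine key hI (α ≫ β) (fun x => d x * c x) (fun U s x => ?_) z hzI ?_ x.1 hx
      · rw [homApply_comp, hd, hc]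
        ring
      · simp [hc0 z hzJ]
  · rw [s.2.1 x hx, mul_zero, mul_zero]

end Coefficient

/-! ### Uniqueness of decompositions -/

section Uniqueness

variable {k : Type u} [Field k]

/-- Take the coefficients of `θ` and of its inverse at one point `x` of `S`. Paths from `k_S` to
`k_S` through a summand other than `k_S` contribute zero, so the blocks indexed by the summands
`k_S` already satisfy `M * M' = 1`, and `M'` is injective. -/
theorem card_le_card_of_iso {P : Type v} {Q : Type w} [Finite P] [Finite Q] {I : P → Set ℝ}
    {J : Q → Set ℝ} (hI : ∀ p, IsInterval (I p)) (hJ : ∀ q, IsInterval (J q))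
    (θ : (⨁ fun p => kSheaf k (I p)) ≅ ⨁ fun q => kSheaf k (J q)) (S : Set ℝ) :
    Nat.card {p // I p = S} ≤ Nat.card {q // J q = S} := by
  classical
  cases nonempty_fintype P
  cases nonempty_fintype Q
  rcases isEmpty_or_nonempty {p // I p = S} with hempty | ⟨⟨p₀, hp₀⟩⟩
  · simp
  obtain ⟨x, hx⟩ := (hI p₀).1
  rw [hp₀] at hx
  let a (p : P) (q : Q) : kSheaf k (I p) ⟶ kSheaf k (J q) :=
    biproduct.ι (fun p => kSheaf k (I p)) p ≫ θ.hom ≫ biproduct.π (fun q => kSheaf k (J q)) q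
  let a' (q : Q) (p : P) : kSheaf k (J q) ⟶ kSheaf k (I p) :=
    biproduct.ι (fun q => kSheaf k (J q)) q ≫ θ.inv ≫ biproduct.π (fun p => kSheaf k (I p)) p
  have hsum : ∀ p p', ∑ q, a p q ≫ a' q p' =
      biproduct.ι (fun p => kSheaf k (I p)) p ≫ biproduct.π (fun p => kSheaf k (I p)) p' := by
    intro p p'
    have h1 : ∀ q, a p q ≫ a' q p' = (biproduct.ι (fun p => kSheaf k (I p)) p ≫ θ.hom) ≫
        (biproduct.π (fun q => kSheaf k (J q)) q ≫ biproduct.ι (fun q => kSheaf k (J q)) q) ≫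
          (θ.inv ≫ biproduct.π (fun p => kSheaf k (I p)) p') := fun q => by
      simp only [a, a', Category.assoc]
    simp only [h1]
    rw [← Preadditive.comp_sum, ← Preadditive.sum_comp, sum_biproduct_π_ι]
    simp
  choose c hc hc0 _ using fun p q => exists_coeff (hI p).2 (a p q)
  choose c' hc' hc0' _ using fun q p => exists_coeff (hJ q).2 (a' q p)
  have hprod : ∀ p p' : {p // I p = S}, ∑ q, c' q p'.1 x * c p.1 q x = if p = p' then 1 else 0 := by
    rintro ⟨p, hp⟩ ⟨p', hp'⟩
    obtain ⟨W, hxW, e, he⟩ := exists_section_eq_one k (hI p).2 (hp.symm ▸ hx : x ∈ I p)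
    have hex : e.1 ⟨x, hxW⟩ = 1 := he _ (hp.symm ▸ hx)
    let T : (kSheaf k (I p) ⟶ kSheaf k (I p')) →+ k :=
      { toFun := fun γ => (homApply γ e).1 ⟨x, hxW⟩
        map_zero' := rfl
        map_add' := fun _ _ => rfl }
    have h1 := congrArg T (hsum p p')
    rw [map_sum] at h1
    have h2 : ∀ q, T (a p q ≫ a' q p') = c' q p' x * c p q x := by
      intro q
      change (homApply (a' q p') (homApply (a p q) e)).1 ⟨x, hxW⟩ = _
      rw [hc', hc, hex, mul_one]
    simp only [h2] at h1
    rw [h1]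
    by_cases hpp : p = p'
    · subst hpp
      rw [biproduct.ι_π_self, if_pos rfl]
      exact hex
    · rw [biproduct.ι_π_ne _ hpp, if_neg (by simpa using hpp), map_zero]
  have hzero : ∀ (p p' : {p // I p = S}) (q : Q), J q ≠ S → c' q p'.1 x * c p.1 q x = 0 := by
    rintro ⟨p, hp⟩ ⟨p', hp'⟩ q hq
    obtain ⟨W, hxW, e, he⟩ := exists_section_eq_one k (hI p).2 (hp.symm ▸ hx : x ∈ I p)
    have hex : e.1 ⟨x, hxW⟩ = 1 := he _ (hp.symm ▸ hx)
    have hpp : I p' = I p := hp'.trans hp.symm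
    -- The intervals `I p'` and `I p` are equal only propositionally; a variable `L` avoids
    -- transporting morphisms.
    have h1 : ∀ (L : Set ℝ) (_ : L = I p) (β : kSheaf k (J q) ⟶ kSheaf k L),
        (homApply β (homApply (a p q) e)).1 ⟨x, hxW⟩ = 0 := by
      rintro L rfl β
      exact homApply_comp_eq_zero (hI p).2 (hJ q).2 (fun h => hq (h ▸ hp)) _ _ _ _
    have h2 := h1 _ hpp (a' q p')
    rwa [hc', hc, hex, mul_one] at h2
  let M : Matrix {p // I p = S} {q // J q = S} k := .of fun p q => c' q.1 p.1 x
  let M' : Matrix {q // J q = S} {p // I p = S} k := .of fun q p => c p.1 q.1 x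
  have hM : M * M' = 1 := by
    ext p' p
    rw [Matrix.mul_apply, Matrix.one_apply]
    have h1 := hprod p p'
    rw [← Finset.sum_subset (Finset.subset_univ (Finset.univ.filter fun q => J q = S))
      (fun q _ hq => hzero p p' q (by simpa using hq))] at h1
    rw [Finset.sum_subtype (p := fun q => J q = S) _ (by simp)] at h1
    simpa [M, M', eq_comm] using h1
  have hinj : Function.Injective M'.mulVecLin := by
    intro v w h
    have h1 : M'.mulVec v = M'.mulVec w := h
    have h2 := congrArg M.mulVec h1
    simpa [Matrix.mulVec_mulVec, hM] using h2
  have := LinearMap.finrank_le_finrank_of_injective hinj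
  simpa [Nat.card_eq_fintype_card] using this

theorem card_sigma_fin {B : Type v} {J : B → Set ℝ} (hJ : Function.Injective J) (m : B → ℕ)
    (b : B) : Nat.card {q : Σ b, Fin (m b) // J q.1 = J b} = m b := by
  have h : Function.Bijective fun i : Fin (m b) =>
      (⟨⟨b, i⟩, rfl⟩ : {q : Σ b, Fin (m b) // J q.1 = J b}) := by
    constructor
    · intro i i' h
      simpa using h
    · rintro ⟨⟨b', i⟩, h⟩
      obtain rfl := hJ h
      exact ⟨i, rfl⟩
  rw [← Nat.card_eq_of_bijective _ h, Nat.card_fin]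

theorem exists_le_of_isDecomposition {F : Sh k ℝ} {A : Type v} {B : Type w} [Finite A] [Finite B]
    {I : A → Set ℝ} {n : A → ℕ} {J : B → Set ℝ} {m : B → ℕ} (hI : IsDecomposition F I n)
    (hIinj : Function.Injective I) (hn : ∀ a, 0 < n a) (hJ : IsDecomposition F J m)
    (hJinj : Function.Injective J) (a : A) : ∃ b, J b = I a ∧ n a ≤ m b := by
  obtain ⟨hI, ⟨e⟩⟩ := hI
  obtain ⟨hJ, ⟨e'⟩⟩ := hJ
  have hle := card_le_card_of_iso (k := k) (I := fun p : Σ a, Fin (n a) => I p.1)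
    (J := fun q : Σ b, Fin (m b) => J q.1) (fun p => hI p.1) (fun q => hJ q.1)
    ((biproductBiproductIso _ fun a (_ : Fin (n a)) => kSheaf k (I a)).symm ≪≫ e.symm ≪≫ e' ≪≫
      biproductBiproductIso _ fun b (_ : Fin (m b)) => kSheaf k (J b)) (I a)
  rw [card_sigma_fin hIinj] at hle
  obtain ⟨⟨⟨b, i⟩, hb⟩⟩ := (Nat.card_pos_iff.1 ((hn a).trans_le hle)).1
  refine ⟨b, hb, ?_⟩
  rw [← hb] at hle
  exact hle.trans_eq (card_sigma_fin hJinj m b)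

end Uniqueness

/-! ### Grouping isomorphic summands -/

theorem exists_isDecomposition_of_iso {k : Type u} [Field k] {F : Sh k ℝ} {P : Type} [Finite P]
    {I : P → Set ℝ} (hI : ∀ p, IsInterval (I p)) (e : F ≅ ⨁ fun p => kSheaf k (I p)) :
    ∃ (A : Type) (_ : Finite A) (I : A → Set ℝ) (n : A → ℕ),
      IsDecomposition F I n ∧ Function.Injective I ∧ ∀ a, 0 < n a := by
  let r : P → Set.range I := Set.rangeFactorization I
  let n : Set.range I → ℕ := fun S => Nat.card {p // r p = S}
  let ε : (Σ S, Fin (n S)) ≃ P :=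
    (Equiv.sigmaCongrRight fun S => (Finite.equivFin {p // r p = S}).symm).trans
      (Equiv.sigmaFiberEquiv r)
  have hε : ∀ q, I (ε q) = q.1 := fun q =>
    congrArg Subtype.val ((Finite.equivFin {p // r p = q.1}).symm q.2).2
  refine ⟨Set.range I, inferInstance, Subtype.val, n, ⟨?_, ⟨?_⟩⟩, Subtype.val_injective, ?_⟩
  · rintro ⟨_, p, rfl⟩
    exact hI p
  · exact e ≪≫ (biproduct.whiskerEquiv ε fun q => eqToIso (by rw [hε])).symm ≪≫
      (biproductBiproductIso _ fun (S : Set.range I) (_ : Fin (n S)) => kSheaf k S.1).symm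
  · rintro ⟨_, p, rfl⟩
    exact Nat.card_pos_iff.2 ⟨⟨⟨p, rfl⟩⟩, inferInstance⟩

end SheavesOnR

end

/-! ### Existence and uniqueness of the decomposition -/

theorem mainTheorem5 (k : Type u) [Field k] (F : SheavesOnR.Sh k ℝ)
    (hF : SheavesOnR.IsConstructible F) (hsupp : IsCompact (SheavesOnR.supp F)) :
    (∃ (A : Type) (_ : Finite A) (I : A → Set ℝ) (n : A → ℕ),
      SheavesOnR.IsDecomposition F I n ∧ Function.Injective I ∧ ∀ a, 0 < n a) ∧
    (∀ (A : Type v) (B : Type w) [Finite A] [Finite B] (I : A → Set ℝ) (n : A → ℕ)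
      (J : B → Set ℝ) (m : B → ℕ),
      SheavesOnR.IsDecomposition F I n → Function.Injective I → (∀ a, 0 < n a) →
      SheavesOnR.IsDecomposition F J m → Function.Injective J → (∀ b, 0 < m b) →
      ∃ σ : A ≃ B, ∀ a, J (σ a) = I a ∧ m (σ a) = n a) := by
  constructor
  · obtain ⟨T, hT⟩ := hF.exists_isAdapted hsupp
    obtain ⟨P, _, I, hI, ⟨e⟩⟩ := hT.exists_iso (SheavesOnR.stratumIndex_le T)
    exact SheavesOnR.exists_isDecomposition_of_iso hI e
  · intro A B _ _ I n J m hI hIinj hn hJ hJinj hm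
    choose σ hσ hle using SheavesOnR.exists_le_of_isDecomposition hI hIinj hn hJ hJinj
    have hge : ∀ a, m (σ a) ≤ n a := by
      intro a
      -- The comparison in the other direction returns to the same `a`, as the intervals are
      -- pairwise distinct.
      obtain ⟨a', ha', h⟩ := SheavesOnR.exists_le_of_isDecomposition hJ hJinj hm hI hIinj (σ a)
      rwa [hIinj (ha'.trans (hσ a))] at h
    have hbij : Function.Bijective σ := by
      constructor
      · intro a a' h
        exact hIinj (by rw [← hσ, ← hσ, h])
      · intro b
        obtain ⟨a, ha, -⟩ := SheavesOnR.exists_le_of_isDecomposition hJ hJinj hm hI hIinj b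
        exact ⟨a, hJinj ((hσ a).trans ha)⟩
    exact ⟨Equiv.ofBijective σ hbij, fun a => ⟨hσ a, (hge a).antisymm (hle a)⟩⟩
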